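/- \textbf{Model.} A receiver is at the origin of the ground plane. There are $K$ layers of transmitters; those of layer $k$ are at altitude $h_k>0$, transmit with power $P_k>0$, and their horizontal positions form a homogeneous Poisson point process in $\mathbb{R}^2$ of density $\lambda_k\ge 0$, the layers being independent. A link of length $x$ from layer $k$ to the receiver is, independently of everything else, line of sight (L) with probability $\rho_k^{(L)}(x)=\bigl(1+a\exp(-b[\sin^{-1}(h_k/x)-a])\bigr)^{-1}$ and non line of sight (N) with probability $\rho_k^{(N)}(x)=1-\rho_k^{(L)}(x)$, where $a\ge 0$ and $b\in\mathbb{R}$. The pathloss exponents satisfy $2<\alpha^{(L)}\le\alpha^{(N)}$. All links have independent Rayleigh fading: a link of length $x$, state $c$ and gain $G\sim\exp(1)$ has received power $P_kGx^{-\alpha^{(c)}}$ and average received power $P_kx^{-\alpha^{(c)}}$ (this is Nakagami fading with $m^{(L)}=m^{(N)}=1$). The receiver is served by the transmitter with the strongest average received power. The successful transmission probability (STP) $\mathcal{P}(\lambda_1,\dots,\lambda_K)$ is the probability that there is a serving transmitter and that its received power divided by the sum of the received powers of all other transmitters plus the noise power $\sigma^2\ge 0$ exceeds the target $\beta>0$.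 \textbf{Claim.} Let $j$ be a layer with $h_j\ge 1$ or $\alpha^{(L)}=\alpha^{(N)}$. Put $\mathcal{S}_j^{(L)}(y)=\beta/(P_jy^{-\alpha^{(L)}})$ and $$\epsilon_j(s)=\int_{h_j}^\infty x\left(1-\frac{\rho_j^{(L)}(x)}{1+sP_jx^{-\alpha^{(L)}}}-\frac{\rho_j^{(N)}(x)}{1+sP_jx^{-\alpha^{(N)}}}\right)dx ,\qquad \lambda_j^b=\frac{1}{2\pi\,\epsilon_j(\mathcal{S}_j^{(L)}(h_j))} .$$ The integral that defines $\epsilon_j(\mathcal{S}_j^{(L)}(h_j))$ converges absolutely. Whatever the densities $\lambda_k\ge 0$ of the other layers, if $\lambda_j^*\ge 0$ is an optimal density of layer $j$, i.e. the STP at $\lambda_j=\lambda_j^*$ is at least the STP at $\lambda_j=t$ for every $t>0$ (other densities unchanged), then $\lambda_j^*\le\lambda_j^b$. The number $\lambda_j^b$ depends on $a,b,\beta,\alpha^{(L)},\alpha^{(N)},h_j,P_j$ only, and not on the densities, altitudes or powers of the other layers. Consequently, if $h_k\ge1$ for all $k$ or $\alpha^{(L)}=\alpha^{(N)}$, and densities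 $(\lambda_k^*)_k$ are such that each $\lambda_k^*$ is optimal given the others (in particular if they maximize the STP jointly over all nonnegative densities), then $\sum_k\lambda_k^*\le\sum_k\lambda_k^b$. -/

import Mathlib

open MeasureTheory ProbabilityTheory Set
open scoped ENNReal NNReal

noncomputable section

namespace MAN

/-! ### Poisson point processes -/

/-- A (simple) Poisson point process on `E` with intensity measure `Λ`: a random set of points
such that the number of points in a measurable set `B` of finite intensity is a random variable
with the Poisson law of mean `Λ B`, and the numbers of points in finitely many pairwise disjoint
measurable sets are independent. -/
structure IsPoissonPointProcess {Ω E : Type*} [MeasurableSpace Ω] [MeasurableSpace E]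
    (Φ : Ω → Set E) (Λ : Measure E) (μ : Measure Ω) : Prop where
  measurable_count : ∀ B : Set E, MeasurableSet B → Measurable fun ω => (Φ ω ∩ B).encard
  poisson_count : ∀ B : Set E, MeasurableSet B → Λ B ≠ ∞ → ∀ n : ℕ,
    μ {ω | (Φ ω ∩ B).encard = n} = poissonMeasure (Λ B).toNNReal {n}
  indep_count : ∀ (m : ℕ) (B : Fin m → Set E), (∀ i, MeasurableSet (B i)) →
    Pairwise (fun i i' => Disjoint (B i) (B i')) →
    iIndepFun (fun i ω => (Φ ω ∩ B i).encard) μ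

/-! ### Channel model -/

/-- The state of a link: line of sight (`los`) or non line of sight (`nlos`). -/
inductive Channel where
  | los : Channel
  | nlos : Channel

instance : MeasurableSpace Channel := ⊤

/-- The position of a node in its layer, projected to the ground plane. -/
abbrev Plane : Type := EuclideanSpace ℝ (Fin 2)

/-- A transmitting node: the index of its layer, its horizontal position, the state of its link to
the receiver, and the fading gain of that link. -/
abbrev Node (K : ℕ) : Type := Fin K × Plane × Channel × ℝ

/-- Distance between the receiver, which is at the origin of the ground plane, and a transmitter at
altitude `h` above the point `x` of the plane. -/
def linkDist (h : ℝ) (x : Plane) : ℝ := Real.sqrt (‖x‖ ^ 2 + h ^ 2)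

/-- Probability that a link of length `x` to a transmitter at altitude `h` is line of sight
(`a`, `b` are the parameters of the environment). -/
def losProb (a b h x : ℝ) : ℝ := 1 / (1 + a * Real.exp (-b * (Real.arcsin (h / x) - a)))

/-- Probability that a link of length `x` to a transmitter at altitude `h` is in state `c`. -/
def channelProb (a b h : ℝ) : Channel → ℝ → ℝ
  | .los, x => losProb a b h x
  | .nlos, x => 1 - losProb a b h x

/-- Intensity, for unit density, of the transmitters of layer `k` whose link is in state `c`:
density `channelProb a b (h k) c` of the link distance in the plane, and fading gains that are
exponential of mean one (Rayleigh fading) and independent of the positions. -/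
def channelIntensity {K : ℕ} (a b : ℝ) (h : Fin K → ℝ) (k : Fin K) (c : Channel) :
    Measure (Node K) :=
  (((volume : Measure Plane).withDensity
      fun x => ENNReal.ofReal (channelProb a b (h k) c (linkDist (h k) x))).prod
    (expMeasure 1)).map fun q => (k, q.1, c, q.2)

/-- Intensity measure of the marked process of all transmitters. The `k`-th layer is a homogeneous
Poisson process of density `lam k` in the plane; each of its points is, independently, marked with
its link state (state `c` has probability `channelProb a b (h k) c` of the link distance) and with
a Rayleigh fading power gain (exponential of mean one), independent of all the rest. -/
def intensity {K : ℕ} (a b : ℝ) (h lam : Fin K → ℝ) : Measure (Node K) :=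
  ∑ k, ENNReal.ofReal (lam k) •
    (channelIntensity a b h k .los + channelIntensity a b h k .nlos)

/-! ### Received power, association, and success -/

section Success

variable {K : ℕ} (α : Channel → ℝ) (h P : Fin K → ℝ)

/-- Average (over the fading) power received from a node: `P_k d ^ (-α)`, where `d` is the link
distance and `α` the pathloss exponent of the state of the link. -/
def avgPower (z : Node K) : ℝ :=
  P z.1 * linkDist (h z.1) z.2.1 ^ (-α z.2.2.1)

/-- Power received from a node: the average power times the fading gain. -/
def rxPower (z : Node K) : ℝ≥0∞ := ENNReal.ofReal (z.2.2.2 * avgPower α h P z)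

/-- Signal to interference plus noise ratio of the link to the node `z`, when the set of all
transmitters is `S` and the noise power is `noise`. -/
def sinr (noise : ℝ) (S : Set (Node K)) (z : Node K) : ℝ≥0∞ :=
  rxPower α h P z / ((∑' w : ↥(S \ {z}), rxPower α h P w) + ENNReal.ofReal noise)

/-- The node `z` is selected by the receiver: it has the strongest average received power. -/
def IsMain (S : Set (Node K)) (z : Node K) : Prop :=
  z ∈ S ∧ ∀ w ∈ S, avgPower α h P w ≤ avgPower α h P z

/-- The successful transmission probability (STP): the probability that there is a selected node
and that the ratio `sinr` of its link exceeds the target `β`. -/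
def stp (β noise : ℝ) {Ω : Type*} [MeasurableSpace Ω] (μ : Measure Ω)
    (Φ : Ω → Set (Node K)) : ℝ :=
  μ.real {ω | ∃ z, IsMain α h P (Φ ω) z ∧ ENNReal.ofReal β < sinr α h P noise (Φ ω) z}

end Success

/-- Given the other coordinates of `lam`, the density `lam j` of layer `j` is optimal: it maximizes
the successful transmission probability `F`, seen as a function of the densities of the layers. -/
def IsOptimalDensity {K : ℕ} (F : (Fin K → ℝ) → ℝ) (lam : Fin K → ℝ) (j : Fin K) : Prop :=
  0 ≤ lam j ∧ ∀ t : ℝ, 0 < t → F (Function.update lam j t) ≤ F lam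

/-! ### The bound -/

/-- `𝒮(y) = β / (P y ^ (-α))` (Rayleigh fading). -/
def scaledTarget (β P α y : ℝ) : ℝ := β / (P * y ^ (-α))

/-- The integrand of `ε(s)`. -/
def epsIntegrand (a b : ℝ) (α : Channel → ℝ) (h P s x : ℝ) : ℝ :=
  x * (1 - channelProb a b h .los x / (1 + s * P * x ^ (-α .los))
    - channelProb a b h .nlos x / (1 + s * P * x ^ (-α .nlos)))

/-- `ε(s)` for a layer of altitude `h` and transmission power `P`. -/
def eps (a b : ℝ) (α : Channel → ℝ) (h P s : ℝ) : ℝ :=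
  ∫ x in Ioi h, epsIntegrand a b α h P s x

/-- The bound `1 / (2 π ε(𝒮(h)))` for a layer of altitude `h` and transmission power `P`, where
`𝒮` is taken for a line-of-sight link. -/
def densityBound (a b β : ℝ) (α : Channel → ℝ) (h P : ℝ) : ℝ :=
  1 / (2 * Real.pi * eps a b α h P (scaledTarget β P (α .los) h))

end MAN

end

/-! Write the intensity as `t Λ + Λ'`, with `t` the density of layer `j`, `Λ` its unit intensity and
`Λ'` the other layers. The STP is the integral over nodes `z` of the probability that `z` serves
successfully. Under Rayleigh fading, a node of average power `q` contributes `exp(-βν/q) exp(-t A(z)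
- A'(z))`. With `s = β/q`, `A(z)` is the `Λ`-integral of `1` over nodes stronger than `z` (there
must be none) and of `1 - exp(-s r)` over weaker nodes of received power `r`; `A'` is its analogue
for `Λ'`. Hence STP(t) = `∫ t exp(-tA) g dΛ + ∫ exp(-tA) g dΛ'` with `g` free of `t`. The second
term is nonincreasing, and `t exp(-tA)` decreases strictly for `t ≥ 1/A`. A node of layer `j` has
average power at most `P_j h_j^(-α_L)` (`avgPower_le`; this is where `h_j ≥ 1` or equal exponents
enter). So its `s` is at least the scaled target at `h_j`, and `A(z)` is at least `2π ε_j`, the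
inverse of the bound (`ofReal_two_pi_eps_le_exponentBelow`). The STP thus decreases strictly above
the bound (`stp_update_lt`).

The integral formula is `measure_served`. The process is given only through its counts, so the
formula is built from them: Laplace functional (`laplace`), independence of a count from a sum over
points outside the counted set (`indepFun_count_lintegral`), and a Campbell formula
(`lintegral_setLIntegral`). The interference seen by `z` depends on `z` through its level, so
average powers are quantized in steps `1/n`: within one cell the interference is a single variable
that ignores the cell, and Campbell applies. Then `n → ∞`, using that a.s. powers are distinct and
finitely many exceed any `δ > 0`; finally `δ → 0`. -/

namespace MAN

open Filter Topology

/-! ### The exponential of the opposite of an extended nonnegative number -/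

/-- `exp (-x)` for `x` in `[0, ∞]`. -/
noncomputable def expNeg (x : ℝ≥0∞) : ℝ≥0∞ := EReal.exp (-(x : EReal))

lemma expNeg_zero : expNeg 0 = 1 := by simp [expNeg]

lemma expNeg_top : expNeg ∞ = 0 := by simp [expNeg]

lemma expNeg_add (x y : ℝ≥0∞) : expNeg (x + y) = expNeg x * expNeg y := by
  simp only [expNeg, EReal.exp_neg, EReal.coe_ennreal_add, EReal.exp_add]
  rw [ENNReal.mul_inv]
  · left; simp
  · right; simp

lemma expNeg_ofReal {r : ℝ} (hr : 0 ≤ r) :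
    expNeg (ENNReal.ofReal r) = ENNReal.ofReal (Real.exp (-r)) := by
  rw [expNeg, EReal.coe_ennreal_ofReal, max_eq_left hr, ← EReal.coe_neg, EReal.exp_coe]

lemma expNeg_antitone : Antitone expNeg := fun x y h => by
  rw [expNeg, expNeg, EReal.exp_le_exp_iff, EReal.neg_le_neg_iff]
  exact_mod_cast h

lemma expNeg_le_one (x : ℝ≥0∞) : expNeg x ≤ 1 := expNeg_zero ▸ expNeg_antitone zero_le

lemma expNeg_ne_top (x : ℝ≥0∞) : expNeg x ≠ ∞ := ((expNeg_le_one x).trans_lt (by simp)).ne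

lemma expNeg_pos {x : ℝ≥0∞} (hx : x ≠ ∞) : 0 < expNeg x := by
  rw [expNeg, EReal.zero_lt_exp_iff, bot_lt_iff_ne_bot]
  simpa using hx

lemma continuous_expNeg : Continuous expNeg := by
  refine ENNReal.continuous_exp.comp ?_
  exact continuous_coe_ennreal_ereal.neg

lemma measurable_expNeg : Measurable expNeg := continuous_expNeg.measurable

lemma expNeg_sum {ι : Type*} (s : Finset ι) (f : ι → ℝ≥0∞) :
    expNeg (∑ i ∈ s, f i) = ∏ i ∈ s, expNeg (f i) := by
  classical
  induction s using Finset.induction_on with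
  | empty => simp [expNeg_zero]
  | insert i s hi ih => rw [Finset.sum_insert hi, Finset.prod_insert hi, expNeg_add, ih]

/-- Also valid for `c = ∞`, `n = 0`, where both sides are `1`; infinite weights thus encode void
probabilities. -/
lemma expNeg_mul_natCast (c : ℝ≥0∞) (n : ℕ) : expNeg (c * n) = expNeg c ^ n := by
  have := expNeg_sum (Finset.range n) fun _ => c
  simpa [mul_comm] using this

lemma one_sub_expNeg_le (x : ℝ≥0∞) : 1 - expNeg x ≤ x := by
  induction x using ENNReal.recTopCoe with
  | top => simp
  | coe x =>
    rw [← ENNReal.ofReal_coe_nnreal, expNeg_ofReal x.coe_nonneg, ← ENNReal.ofReal_one,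
      ← ENNReal.ofReal_sub _ (Real.exp_pos _).le]
    exact ENNReal.ofReal_le_ofReal (by linarith [Real.add_one_le_exp (-(x : ℝ))])

/-! ### The counting measure of a set of points -/

section Counting

variable {Ω E : Type*} [MeasurableSpace Ω] [MeasurableSpace E]

/-- The measure that puts a unit mass at each point of `S`. -/
noncomputable def pointMeasure (S : Set E) : Measure E := Measure.sum fun z : S => Measure.dirac (z : E)

lemma pointMeasure_apply (S : Set E) {B : Set E} (hB : MeasurableSet B) :
    pointMeasure S B = ((S ∩ B).encard : ℝ≥0∞) := by
  rw [pointMeasure, Measure.sum_apply _ hB]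
  simp only [Measure.dirac_apply' _ hB]
  rw [← ENNReal.tsum_set_one, tsum_subtype (S ∩ B) fun _ => (1 : ℝ≥0∞),
    tsum_subtype S fun z => B.indicator (1 : E → ℝ≥0∞) z]
  congr 1
  ext z
  by_cases h1 : z ∈ S <;> by_cases h2 : z ∈ B <;> simp [h1, h2]

lemma lintegral_pointMeasure (S : Set E) {f : E → ℝ≥0∞} (hf : Measurable f) :
    ∫⁻ z, f z ∂pointMeasure S = ∑' z : S, f z := by
  rw [pointMeasure, lintegral_sum_measure]
  simp only [lintegral_dirac' _ hf]

lemma restrict_pointMeasure (S : Set E) {B : Set E} (hB : MeasurableSet B) :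
    (pointMeasure S).restrict B = pointMeasure (S ∩ B) := by
  ext C hC
  rw [Measure.restrict_apply hC, pointMeasure_apply _ (hC.inter hB), pointMeasure_apply _ hC]
  congr 2; ext; simp; tauto

end Counting

/-! ### Poisson random variables -/

lemma lintegral_poissonMeasure (r : ℝ≥0) (φ : ℕ → ℝ≥0∞) :
    ∫⁻ n, φ n ∂poissonMeasure r
      = ∑' n, ENNReal.ofReal (Real.exp (-r) * r ^ n / n.factorial) * φ n := by
  rw [lintegral_countable']
  simp_rw [poissonMeasure_singleton]
  exact tsum_congr fun n => mul_comm _ _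

lemma tsum_poisson (r : ℝ≥0) :
    ∑' n : ℕ, ENNReal.ofReal (Real.exp (-r) * r ^ n / n.factorial) = 1 := by
  have := lintegral_poissonMeasure r fun _ => 1
  simpa using this.symm

lemma lintegral_natCast_poissonMeasure (r : ℝ≥0) : ∫⁻ n, (n : ℝ≥0∞) ∂poissonMeasure r = r := by
  rw [lintegral_poissonMeasure, tsum_eq_zero_add' ENNReal.summable]
  simp only [Nat.cast_zero, mul_zero, zero_add]
  have : ∀ n : ℕ, ENNReal.ofReal (Real.exp (-r) * r ^ (n + 1) / (n + 1).factorial) * (n + 1 : ℕ)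
      = r * ENNReal.ofReal (Real.exp (-r) * r ^ n / n.factorial) := fun n => by
    rw [← ENNReal.ofReal_natCast, ← ENNReal.ofReal_coe_nnreal, ← ENNReal.ofReal_mul (by positivity),
      ← ENNReal.ofReal_mul (by positivity), Nat.factorial_succ]
    congr 1
    push_cast
    field_simp
    ring
  simp_rw [this, ENNReal.tsum_mul_left, tsum_poisson, mul_one]

/-- Quadratic in `r`, hence negligible when summed over fine cells: this is what excludes ties
between powers. -/
lemma poissonMeasure_two_le (r : ℝ≥0) : poissonMeasure r {n | 2 ≤ n} ≤ r ^ 2 := by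
  rw [← lintegral_indicator_one (MeasurableSet.of_discrete), lintegral_poissonMeasure,
    ← Summable.sum_add_tsum_nat_add' (k := 2) ENNReal.summable]
  simp only [Finset.sum_range_succ, Finset.sum_range_zero]
  have : ∀ n : ℕ, ENNReal.ofReal (Real.exp (-r) * r ^ (n + 2) / (n + 2).factorial)
      * ({n | 2 ≤ n} : Set ℕ).indicator 1 (n + 2)
      ≤ r ^ 2 * ENNReal.ofReal (Real.exp (-r) * r ^ n / n.factorial) := fun n => by
    have hi : ({n | 2 ≤ n} : Set ℕ).indicator (1 : ℕ → ℝ≥0∞) (n + 2) = 1 := by simp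
    rw [hi, mul_one, ← ENNReal.ofReal_coe_nnreal,
      ← ENNReal.ofReal_pow r.coe_nonneg, ← ENNReal.ofReal_mul (by positivity)]
    apply ENNReal.ofReal_le_ofReal
    have h : ((n.factorial : ℕ) : ℝ) ≤ (n + 2).factorial := by
      exact_mod_cast Nat.factorial_le (Nat.le_add_right n 2)
    calc Real.exp (-r) * (r : ℝ) ^ (n + 2) / (n + 2).factorial
        ≤ Real.exp (-r) * (r : ℝ) ^ (n + 2) / n.factorial := by gcongr
      _ = _ := by ring
  calc _ ≤ 0 + ∑' n : ℕ, r ^ 2 * ENNReal.ofReal (Real.exp (-r) * r ^ n / n.factorial) := by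
        refine add_le_add (by simp) (ENNReal.tsum_le_tsum this)
    _ = r ^ 2 := by rw [ENNReal.tsum_mul_left, tsum_poisson, zero_add, mul_one]

lemma lintegral_pow_poissonMeasure (r : ℝ≥0) {z : ℝ≥0∞} (hz : z ≤ 1) :
    ∫⁻ n, z ^ n ∂poissonMeasure r = expNeg (r * (1 - z)) := by
  lift z to ℝ≥0 using (hz.trans_lt (by simp)).ne
  have hz' : (z : ℝ) ≤ 1 := by exact_mod_cast hz
  rw [lintegral_poissonMeasure]
  have h1 : ∀ n : ℕ, ENNReal.ofReal (Real.exp (-r) * r ^ n / n.factorial) * (z : ℝ≥0∞) ^ n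
      = ENNReal.ofReal (Real.exp (-r) * ((r * z) ^ n / n.factorial)) := fun n => by
    rw [← ENNReal.ofReal_coe_nnreal, ← ENNReal.ofReal_pow z.coe_nonneg, ← ENNReal.ofReal_mul (by positivity)]
    congr 1
    rw [mul_pow]; ring
  have h2 : HasSum (fun n : ℕ => Real.exp (-r) * ((r * z : ℝ) ^ n / n.factorial))
      (Real.exp (-r) * Real.exp (r * z)) := by
    refine HasSum.mul_left _ ?_
    rw [Real.exp_eq_exp_ℝ]
    exact NormedSpace.expSeries_div_hasSum_exp (r * z : ℝ)
  simp_rw [h1]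
  rw [← ENNReal.ofReal_tsum_of_nonneg (fun n => by positivity) h2.summable, h2.tsum_eq,
    ← Real.exp_add, ← ENNReal.ofReal_coe_nnreal (p := z), ← ENNReal.ofReal_one,
    ← ENNReal.ofReal_sub _ z.coe_nonneg, ← ENNReal.ofReal_coe_nnreal (p := r),
    ← ENNReal.ofReal_mul r.coe_nonneg, expNeg_ofReal (mul_nonneg r.coe_nonneg (by linarith))]
  congr 2; ring

/-! ### Poisson point processes: Laplace functional, independence, Campbell formula -/

section Poisson

variable {Ω E : Type*} [MeasurableSpace Ω] [MeasurableSpace E]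

/-- Cutting the simple approximations off outside the spanning sets makes every nonzero level set of
finite intensity, where the Poisson law of the count is known. -/
lemma exists_simpleFunc_tendsto (Λ : Measure E) [SigmaFinite Λ] {f : E → ℝ≥0∞}
    (hf : Measurable f) :
    ∃ F : ℕ → SimpleFunc E ℝ≥0∞, (∀ z, Monotone fun n => F n z) ∧
      (∀ z, Tendsto (fun n => F n z) atTop (𝓝 (f z))) ∧ (∀ n z, F n z ≤ f z) ∧
      ∀ n c, c ≠ 0 → Λ (F n ⁻¹' {c}) ≠ ∞ := by
  have hS := measurableSet_spanningSets Λ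
  have hF : ∀ n z, ((SimpleFunc.eapprox f n).restrict (spanningSets Λ n)) z
      = (spanningSets Λ n).indicator (SimpleFunc.eapprox f n) z := fun n z =>
    SimpleFunc.restrict_apply _ (hS n) z
  refine ⟨fun n => (SimpleFunc.eapprox f n).restrict (spanningSets Λ n), ?_, ?_, ?_, ?_⟩
  · intro z m n hmn
    simp only [hF]
    exact (indicator_le_indicator_of_subset (monotone_spanningSets Λ hmn) (fun _ => zero_le) z).trans
      (indicator_le_indicator (SimpleFunc.monotone_eapprox f hmn z))
  · intro z
    simp only [hF]
    refine (SimpleFunc.tendsto_eapprox hf z).congr' ?_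
    filter_upwards [eventually_ge_atTop (spanningSetsIndex Λ z)] with n hn
    rw [indicator_of_mem]
    exact monotone_spanningSets Λ hn (mem_spanningSetsIndex Λ z)
  · intro n z
    rw [hF]
    refine (indicator_le_self _ _ z).trans ?_
    rw [← SimpleFunc.iSup_eapprox_apply hf z]
    exact le_iSup (fun n => SimpleFunc.eapprox f n z) n
  · intro n c hc
    refine ((measure_mono ?_).trans_lt (measure_spanningSets_lt_top Λ n)).ne
    intro z hz
    by_contra h
    apply hc
    rw [← (show _ = c from hz), hF, indicator_of_notMem h]

variable {Φ : Ω → Set E} {Λ : Measure E} {μ : Measure Ω}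

namespace IsPoissonPointProcess

lemma measurable_pointMeasure (h : IsPoissonPointProcess Φ Λ μ) :
    Measurable fun ω => pointMeasure (Φ ω) := by
  refine Measure.measurable_of_measurable_coe _ fun B hB => ?_
  simp only [pointMeasure_apply _ hB]
  exact (measurable_from_top (f := fun n : ℕ∞ => (n : ℝ≥0∞))).comp (h.measurable_count B hB)

lemma measurable_count_ennreal (h : IsPoissonPointProcess Φ Λ μ) {B : Set E}
    (hB : MeasurableSet B) : Measurable fun ω => pointMeasure (Φ ω) B :=
  (Measure.measurable_coe hB).comp h.measurable_pointMeasure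

lemma measurable_lintegral (h : IsPoissonPointProcess Φ Λ μ) {f : E → ℝ≥0∞} (hf : Measurable f) :
    Measurable fun ω => ∫⁻ z, f z ∂pointMeasure (Φ ω) :=
  (Measure.measurable_lintegral hf).comp h.measurable_pointMeasure

/-- The two laws agree on finite atoms, and the Poisson masses of these already sum to one.
Comparable probability measures are equal, so the count has no mass at `∞`. -/
lemma map_count [IsProbabilityMeasure μ] (h : IsPoissonPointProcess Φ Λ μ) {B : Set E}
    (hB : MeasurableSet B) (hΛ : Λ B ≠ ∞) :
    μ.map (fun ω => (Φ ω ∩ B).encard) = (poissonMeasure (Λ B).toNNReal).map (Nat.cast : ℕ → ℕ∞) := by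
  have hm := h.measurable_count B hB
  have hfin : ∀ n : ℕ, μ.map (fun ω => (Φ ω ∩ B).encard) {(n : ℕ∞)}
      = poissonMeasure (Λ B).toNNReal {n} := fun n => by
    rw [Measure.map_apply hm (MeasurableSet.of_discrete), ← h.poisson_count B hB hΛ n]
    rfl
  have hnat : (poissonMeasure (Λ B).toNNReal).map (Nat.cast : ℕ → ℕ∞)
      = Measure.sum fun n : ℕ => poissonMeasure (Λ B).toNNReal {n} • Measure.dirac (n : ℕ∞) := by
    conv_lhs => rw [← Measure.sum_smul_dirac (poissonMeasure (Λ B).toNNReal)]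
    rw [Measure.map_sum (by fun_prop)]
    congr 1; ext1 n
    rw [Measure.map_smul, Measure.map_dirac' (by fun_prop)]
  have : IsProbabilityMeasure (μ.map fun ω => (Φ ω ∩ B).encard) :=
    Measure.isProbabilityMeasure_map hm.aemeasurable
  have hle : (poissonMeasure (Λ B).toNNReal).map (Nat.cast : ℕ → ℕ∞)
      ≤ μ.map (fun ω => (Φ ω ∩ B).encard) := by
    refine Measure.le_iff.2 fun S hS => ?_
    rw [hnat, Measure.sum_apply _ hS]
    simp only [Measure.smul_apply, smul_eq_mul, ← hfin]
    have h1 : ∀ n : ℕ, μ.map (fun ω => (Φ ω ∩ B).encard) {(n : ℕ∞)}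
        * Measure.dirac (n : ℕ∞) S
        = μ.map (fun ω => (Φ ω ∩ B).encard) ({(n : ℕ∞)} ∩ S) := fun n => by
      rw [Measure.dirac_apply' _ hS]
      by_cases hn : (n : ℕ∞) ∈ S
      · simp [hn]
      · simp [hn]
    simp only [h1]
    rw [← measure_iUnion]
    · exact measure_mono (iUnion_subset fun n => inter_subset_right)
    · intro i j hij
      refine Disjoint.mono inter_subset_left inter_subset_left ?_
      simpa using hij
    · exact fun n => MeasurableSet.of_discrete
  have : IsProbabilityMeasure ((poissonMeasure (Λ B).toNNReal).map (Nat.cast : ℕ → ℕ∞)) :=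
    Measure.isProbabilityMeasure_map (by fun_prop)
  exact (Measure.eq_of_le_of_isProbabilityMeasure hle).symm

lemma lintegral_comp_count [IsProbabilityMeasure μ] (h : IsPoissonPointProcess Φ Λ μ) {B : Set E}
    (hB : MeasurableSet B) (hΛ : Λ B ≠ ∞) (φ : ℝ≥0∞ → ℝ≥0∞) :
    ∫⁻ ω, φ (pointMeasure (Φ ω) B) ∂μ = ∫⁻ n, φ (n : ℝ≥0∞) ∂poissonMeasure (Λ B).toNNReal := by
  simp only [pointMeasure_apply _ hB]
  rw [← lintegral_map (f := fun n : ℕ∞ => φ (n : ℝ≥0∞)) measurable_from_top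
    (h.measurable_count B hB), h.map_count hB hΛ, lintegral_map measurable_from_top (by fun_prop)]
  simp

lemma lintegral_count [IsProbabilityMeasure μ] (h : IsPoissonPointProcess Φ Λ μ) {B : Set E}
    (hB : MeasurableSet B) (hΛ : Λ B ≠ ∞) :
    ∫⁻ ω, pointMeasure (Φ ω) B ∂μ = Λ B := by
  refine (h.lintegral_comp_count hB hΛ id).trans ?_
  simp only [id, lintegral_natCast_poissonMeasure, ENNReal.coe_toNNReal hΛ]

lemma ae_count_lt_top [IsProbabilityMeasure μ] (h : IsPoissonPointProcess Φ Λ μ) {B : Set E}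
    (hB : MeasurableSet B) (hΛ : Λ B ≠ ∞) : ∀ᵐ ω ∂μ, pointMeasure (Φ ω) B < ∞ := by
  refine ae_lt_top (h.measurable_count_ennreal hB) ?_
  rwa [h.lintegral_count hB hΛ]

lemma measure_two_le_count [IsProbabilityMeasure μ] (h : IsPoissonPointProcess Φ Λ μ) {B : Set E}
    (hB : MeasurableSet B) (hΛ : Λ B ≠ ∞) :
    μ {ω | 2 ≤ pointMeasure (Φ ω) B} ≤ Λ B ^ 2 := by
  have := h.lintegral_comp_count hB hΛ ({x | 2 ≤ x}.indicator 1)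
  have h2 : MeasurableSet {ω | 2 ≤ pointMeasure (Φ ω) B} :=
    measurableSet_le measurable_const (h.measurable_count_ennreal hB)
  rw [← lintegral_indicator_one h2]
  refine (le_of_eq this).trans ?_
  have h3 : (fun n : ℕ => ({x | 2 ≤ x} : Set ℝ≥0∞).indicator (1 : ℝ≥0∞ → ℝ≥0∞) (n : ℝ≥0∞))
      = ({n | 2 ≤ n} : Set ℕ).indicator 1 := by
    ext n
    simp only [indicator, mem_ofPred_eq, Nat.ofNat_le_cast, Pi.one_apply]
  rw [h3, lintegral_indicator_one MeasurableSet.of_discrete]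
  refine (poissonMeasure_two_le _).trans (le_of_eq ?_)
  rw [ENNReal.coe_toNNReal hΛ]

lemma laplace_count [IsProbabilityMeasure μ] (h : IsPoissonPointProcess Φ Λ μ) {B : Set E}
    (hB : MeasurableSet B) (hΛ : Λ B ≠ ∞) (c : ℝ≥0∞) :
    ∫⁻ ω, expNeg (c * pointMeasure (Φ ω) B) ∂μ = expNeg ((1 - expNeg c) * Λ B) := by
  rw [h.lintegral_comp_count hB hΛ fun x => expNeg (c * x)]
  simp only [expNeg_mul_natCast]
  rw [lintegral_pow_poissonMeasure _ (expNeg_le_one c), ENNReal.coe_toNNReal hΛ, mul_comm]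

lemma iIndepFun_count (h : IsPoissonPointProcess Φ Λ μ) {ι : Type*} [Fintype ι] {B : ι → Set E}
    (hB : ∀ i, MeasurableSet (B i)) (hd : Pairwise fun i j => Disjoint (B i) (B j)) :
    iIndepFun (fun i ω => pointMeasure (Φ ω) (B i)) μ := by
  have e := Fintype.equivFin ι
  have := h.indep_count _ (fun i => B (e.symm i)) (fun i => hB _)
    (fun i j hij => hd (e.symm.injective.ne hij))
  have := (iIndepFun_precomp_of_bijective (f := fun i ω => (Φ ω ∩ B i).encard)
    e.symm.bijective).1 this
  simp only [pointMeasure_apply _ (hB _)]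
  exact this.comp (fun _ (n : ℕ∞) => (n : ℝ≥0∞)) fun _ => measurable_from_top

/-- The value `0` is dropped because its level set may have infinite intensity or meet the set kept
apart. -/
lemma lintegral_simpleFunc_eq (M : Measure E) (F : SimpleFunc E ℝ≥0∞) :
    ∫⁻ z, F z ∂M = ∑ c : {c // c ∈ F.range.erase 0}, (c : ℝ≥0∞) * M (F ⁻¹' {(c : ℝ≥0∞)}) := by
  rw [SimpleFunc.lintegral_eq_lintegral, SimpleFunc.lintegral,
    Finset.sum_coe_sort _ fun c => c * M (F ⁻¹' {c})]
  refine (Finset.sum_subset (Finset.erase_subset _ _) ?_).symm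
  intro c hc hc'
  have : c = 0 := by
    by_contra h0
    exact hc' (Finset.mem_erase.2 ⟨h0, hc⟩)
  simp [this]

/-- The Laplace functional of a Poisson point process. -/
lemma laplace [IsProbabilityMeasure μ] [SigmaFinite Λ] (h : IsPoissonPointProcess Φ Λ μ)
    {f : E → ℝ≥0∞} (hf : Measurable f) :
    ∫⁻ ω, expNeg (∫⁻ z, f z ∂pointMeasure (Φ ω)) ∂μ = expNeg (∫⁻ z, (1 - expNeg (f z)) ∂Λ) := by
  obtain ⟨F, hmono, hlim, -, hfin⟩ := exists_simpleFunc_tendsto Λ hf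
  -- For a simple function the sum is a combination of independent Poisson counts, so the
  -- expectation factorizes.
  have hsimple : ∀ n, ∫⁻ ω, expNeg (∫⁻ z, F n z ∂pointMeasure (Φ ω)) ∂μ
      = expNeg (∫⁻ z, (1 - expNeg (F n z)) ∂Λ) := fun n => by
    have hB : ∀ c : {c // c ∈ (F n).range.erase 0}, MeasurableSet (F n ⁻¹' {(c : ℝ≥0∞)}) :=
      fun c => (F n).measurableSet_preimage _
    have hind := h.iIndepFun_count hB (fun i j hij => by
      exact Disjoint.preimage _ (disjoint_singleton.2 (Subtype.coe_injective.ne hij)))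
    have hind' := hind.comp (fun c x => expNeg ((c : ℝ≥0∞) * x))
      fun c => measurable_expNeg.comp (measurable_const_mul _)
    simp only [lintegral_simpleFunc_eq, expNeg_sum]
    have := lintegral_prod_eq_prod_lintegral_of_indepFun Finset.univ _ hind'
      fun c => (measurable_expNeg.comp (measurable_const_mul _)).comp
        (h.measurable_count_ennreal (hB c))
    refine this.trans ?_
    have h2 : ∫⁻ z, (1 - expNeg (F n z)) ∂Λ = ∑ c : {c // c ∈ (F n).range.erase 0},
        (1 - expNeg (c : ℝ≥0∞)) * Λ (F n ⁻¹' {(c : ℝ≥0∞)}) := by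
      have h3 := SimpleFunc.map_lintegral (μ := Λ) (fun c => 1 - expNeg c) (F n)
      rw [← SimpleFunc.lintegral_eq_lintegral] at h3
      refine h3.trans ?_
      rw [Finset.sum_coe_sort _ fun c => (1 - expNeg c) * Λ (F n ⁻¹' {c})]
      refine (Finset.sum_subset (Finset.erase_subset _ _) ?_).symm
      intro c hc hc'
      have : c = 0 := by
        by_contra h0
        exact hc' (Finset.mem_erase.2 ⟨h0, hc⟩)
      simp [this, expNeg_zero]
    rw [h2, expNeg_sum]
    refine Finset.prod_congr rfl fun c _ => ?_
    exact h.laplace_count (hB c) (hfin n c (Finset.ne_of_mem_erase c.2)) c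
  have hL : Tendsto (fun n => ∫⁻ ω, expNeg (∫⁻ z, F n z ∂pointMeasure (Φ ω)) ∂μ) atTop
      (𝓝 (∫⁻ ω, expNeg (∫⁻ z, f z ∂pointMeasure (Φ ω)) ∂μ)) := by
    refine tendsto_lintegral_of_dominated_convergence (fun _ => 1)
      (fun n => measurable_expNeg.comp (h.measurable_lintegral (F n).measurable))
      (fun n => Eventually.of_forall fun ω => expNeg_le_one _) (by simp) ?_
    refine Eventually.of_forall fun ω => (continuous_expNeg.tendsto _).comp ?_
    exact lintegral_tendsto_of_tendsto_of_monotone (fun n => (F n).measurable.aemeasurable)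
      (Eventually.of_forall hmono) (Eventually.of_forall hlim)
  have hR : Tendsto (fun n => expNeg (∫⁻ z, (1 - expNeg (F n z)) ∂Λ)) atTop
      (𝓝 (expNeg (∫⁻ z, (1 - expNeg (f z)) ∂Λ))) := by
    refine (continuous_expNeg.tendsto _).comp ?_
    refine lintegral_tendsto_of_tendsto_of_monotone
      (fun n => (measurable_const.sub (measurable_expNeg.comp (F n).measurable)).aemeasurable)
      (Eventually.of_forall fun z m n hmn => tsub_le_tsub_left (expNeg_antitone (hmono z hmn)) _)
      (Eventually.of_forall fun z => ?_)
    exact ENNReal.Tendsto.sub tendsto_const_nhds ((continuous_expNeg.tendsto _).comp (hlim z))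
      (Or.inl (by simp))
  simp only [hsimple] at hL
  exact tendsto_nhds_unique hL hR

/-- The number of points in `B` is independent of the sum over the process of a function that
vanishes on `B`. -/
lemma indepFun_count_lintegral [IsProbabilityMeasure μ] [SigmaFinite Λ]
    (h : IsPoissonPointProcess Φ Λ μ) {B : Set E} (hB : MeasurableSet B) {f : E → ℝ≥0∞}
    (hf : Measurable f) (hfB : ∀ z ∈ B, f z = 0) :
    IndepFun (fun ω => ∫⁻ z, f z ∂pointMeasure (Φ ω)) (fun ω => pointMeasure (Φ ω) B) μ := by
  obtain ⟨F, hmono, hlim, hle, -⟩ := exists_simpleFunc_tendsto Λ hf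
  have hsimple : ∀ n, IndepFun (fun ω => ∫⁻ z, F n z ∂pointMeasure (Φ ω))
      (fun ω => pointMeasure (Φ ω) B) μ := fun n => by
    set ι := {c // c ∈ (F n).range.erase 0}
    -- The index `none` stands for `B`, the others for the level sets of `F n`; these avoid `B`
    -- because `F n ≤ f = 0` there.
    let D : Option ι → Set E := fun o => o.elim B fun c => F n ⁻¹' {(c : ℝ≥0∞)}
    have hD : ∀ o, MeasurableSet (D o) := by
      rintro (_ | c)
      · exact hB
      · exact (F n).measurableSet_preimage _
    have h0 : ∀ c : ι, Disjoint B (F n ⁻¹' {(c : ℝ≥0∞)}) := fun c => by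
      refine Set.disjoint_left.2 fun z hz hz' => Finset.ne_of_mem_erase c.2 ?_
      rw [← (show _ = (c : ℝ≥0∞) from hz')]
      exact le_antisymm (hfB z hz ▸ hle n z) zero_le
    have hdis : Pairwise fun i j => Disjoint (D i) (D j) := by
      rintro (_ | c) (_ | d) hcd
      · exact absurd rfl hcd
      · exact h0 d
      · exact (h0 c).symm
      · have : c ≠ d := fun h => hcd (by rw [h])
        exact Disjoint.preimage _ (disjoint_singleton.2 (Subtype.coe_injective.ne this))
    have hind := (h.iIndepFun_count hD hdis).comp
      (fun o x => (o.elim 1 fun c => (c : ℝ≥0∞)) * x) fun o => measurable_const_mul _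
    have := hind.indepFun_finsetSum_of_notMem (fun o =>
      (measurable_const_mul _).comp (h.measurable_count_ennreal (hD o)))
      (s := Finset.univ.image some) (i := none) (by simp)
    rw [Finset.sum_image (fun _ _ _ _ h => Option.some_injective _ h)] at this
    convert this using 1
    · ext ω
      rw [lintegral_simpleFunc_eq, Finset.sum_apply]
      rfl
    · ext ω
      simp [D]
  set X : Ω → ℝ≥0∞ := fun ω => ∫⁻ z, f z ∂pointMeasure (Φ ω)
  set N : Ω → ℝ≥0∞ := fun ω => pointMeasure (Φ ω) B
  have hXm : Measurable X := h.measurable_lintegral hf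
  have hNm : Measurable N := h.measurable_count_ennreal hB
  have hXlim : ∀ ω, Tendsto (fun n => ∫⁻ z, F n z ∂pointMeasure (Φ ω)) atTop (𝓝 (X ω)) := fun ω =>
    lintegral_tendsto_of_tendsto_of_monotone (fun n => (F n).measurable.aemeasurable)
      (Eventually.of_forall hmono) (Eventually.of_forall hlim)
  have hXmono : ∀ ω, Monotone fun n => ∫⁻ z, F n z ∂pointMeasure (Φ ω) := fun ω m n hmn =>
    lintegral_mono fun z => hmono z hmn
  -- Since the approximating sums increase to `X`, the events `X ≤ c` are decreasing intersections,
  -- so independence passes to the limit; the half-lines `Iic c` are a generating π-system.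
  have hinter : ∀ c, {ω | X ω ≤ c} = ⋂ n, {ω | ∫⁻ z, F n z ∂pointMeasure (Φ ω) ≤ c} := fun c => by
    ext ω
    simp only [mem_ofPred_eq, mem_iInter]
    exact ⟨fun hx n => ((hXmono ω).ge_of_tendsto (hXlim ω) n).trans hx,
      fun hx => le_of_tendsto' (hXlim ω) hx⟩
  have hmeas : ∀ c n, MeasurableSet {ω | ∫⁻ z, F n z ∂pointMeasure (Φ ω) ≤ c} := fun c n =>
    measurableSet_le (h.measurable_lintegral (F n).measurable) measurable_const
  have hanti : ∀ c, Antitone fun n => {ω | ∫⁻ z, F n z ∂pointMeasure (Φ ω) ≤ c} :=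
    fun c m n hmn ω hω => (hXmono ω hmn).trans hω
  have hkey : ∀ c, ∀ T, MeasurableSet T →
      μ ({ω | X ω ≤ c} ∩ N ⁻¹' T) = μ {ω | X ω ≤ c} * μ (N ⁻¹' T) := fun c T hT => by
    have h1 : Tendsto (fun n => μ {ω | ∫⁻ z, F n z ∂pointMeasure (Φ ω) ≤ c}) atTop
        (𝓝 (μ {ω | X ω ≤ c})) := by
      rw [hinter]
      exact tendsto_measure_iInter_atTop (fun n => (hmeas c n).nullMeasurableSet) (hanti c)
        ⟨0, measure_ne_top _ _⟩
    have h2 : Tendsto (fun n => μ ({ω | ∫⁻ z, F n z ∂pointMeasure (Φ ω) ≤ c} ∩ N ⁻¹' T)) atTop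
        (𝓝 (μ ({ω | X ω ≤ c} ∩ N ⁻¹' T))) := by
      rw [hinter, iInter_inter]
      exact tendsto_measure_iInter_atTop
        (fun n => ((hmeas c n).inter (hNm hT)).nullMeasurableSet)
        (fun m n hmn => inter_subset_inter_left _ (hanti c hmn)) ⟨0, measure_ne_top _ _⟩
    refine tendsto_nhds_unique h2 ?_
    have h3 := ENNReal.Tendsto.mul_const (b := μ (N ⁻¹' T)) h1 (Or.inr (measure_ne_top _ _))
    refine h3.congr fun n => ?_
    exact ((hsimple n).measure_inter_preimage_eq_mul (Iic c) T measurableSet_Iic hT).symm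
  rw [IndepFun_iff_Indep]
  refine IndepSets.indep (p1 := preimage X '' range Iic) (p2 := {s | ∃ T, MeasurableSet T ∧ N ⁻¹' T = s})
    hXm.comap_le hNm.comap_le (isPiSystem_Iic.comap X)
    (@MeasurableSpace.isPiSystem_measurableSet _ (MeasurableSpace.comap N inferInstance)) ?_ ?_ ?_
  · rw [BorelSpace.measurable_eq (α := ℝ≥0∞), borel_eq_generateFrom_Iic,
      MeasurableSpace.comap_generateFrom]
  · exact (@MeasurableSpace.generateFrom_measurableSet _ (MeasurableSpace.comap N inferInstance)).symm
  · rw [IndepSets_iff]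
    rintro _ _ ⟨_, ⟨c, rfl⟩, rfl⟩ ⟨T, hT, rfl⟩
    exact hkey c T hT

end IsPoissonPointProcess
end Poisson

/-! ### Campbell formula with an independent sum over the rest of the process -/

section Campbell

variable {Ω E : Type*} [MeasurableSpace Ω] [MeasurableSpace E]
variable {Φ : Ω → Set E} {Λ : Measure E} {μ : Measure Ω}

namespace IsPoissonPointProcess

/-- The restriction to `C` of the counting measure of the process, normalized to mass one. -/
noncomputable def normalizedKernel (h : IsPoissonPointProcess Φ Λ μ) {C : Set E}
    (hC : MeasurableSet C) : Kernel Ω E where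
  toFun ω := (pointMeasure (Φ ω) C)⁻¹ • (pointMeasure (Φ ω)).restrict C
  measurable' := by
    refine Measure.measurable_of_measurable_coe _ fun B hB => ?_
    simp only [Measure.smul_apply, Measure.restrict_apply hB, smul_eq_mul]
    exact (h.measurable_count_ennreal hC).inv.mul (h.measurable_count_ennreal (hB.inter hC))

lemma normalizedKernel_apply (h : IsPoissonPointProcess Φ Λ μ) {C : Set E}
    (hC : MeasurableSet C) (ω : Ω) :
    h.normalizedKernel hC ω = (pointMeasure (Φ ω) C)⁻¹ • (pointMeasure (Φ ω)).restrict C := rfl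

/-- The counting measure itself may be infinite on `C` for exceptional `ω`. After normalization the
mass is at most one everywhere, by the conventions for `0` and `∞`, so the Fubini results for
kernels apply. -/
lemma isFiniteKernel_normalizedKernel (h : IsPoissonPointProcess Φ Λ μ) {C : Set E}
    (hC : MeasurableSet C) : IsFiniteKernel (h.normalizedKernel hC) := by
  refine ⟨1, by simp, fun ω => ?_⟩
  rw [normalizedKernel_apply, Measure.smul_apply, Measure.restrict_apply_univ, smul_eq_mul]
  exact ENNReal.inv_mul_le_one _

lemma setLIntegral_eq_mul_normalizedKernel (h : IsPoissonPointProcess Φ Λ μ) {C : Set E}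
    (hC : MeasurableSet C) {ω : Ω} (hω : pointMeasure (Φ ω) C < ∞) (g : E → ℝ≥0∞) :
    ∫⁻ z in C, g z ∂pointMeasure (Φ ω)
      = pointMeasure (Φ ω) C * ∫⁻ z, g z ∂h.normalizedKernel hC ω := by
  rw [normalizedKernel_apply, lintegral_smul_measure, smul_eq_mul, ← mul_assoc]
  by_cases h0 : pointMeasure (Φ ω) C = 0
  · simp [Measure.restrict_eq_zero.2 h0]
  · rw [ENNReal.mul_inv_cancel h0 hω.ne, one_mul]

variable [IsProbabilityMeasure μ]

lemma aemeasurable_setLIntegral (h : IsPoissonPointProcess Φ Λ μ) {C : Set E}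
    (hC : MeasurableSet C) (hΛ : Λ C ≠ ∞) {k : E × ℝ≥0∞ → ℝ≥0∞} (hk : Measurable k)
    {X : Ω → ℝ≥0∞} (hX : Measurable X) :
    AEMeasurable (fun ω => ∫⁻ z in C, k (z, X ω) ∂pointMeasure (Φ ω)) μ := by
  have := h.isFiniteKernel_normalizedKernel hC
  refine ⟨fun ω => pointMeasure (Φ ω) C * ∫⁻ z, k (z, X ω) ∂h.normalizedKernel hC ω,
    (h.measurable_count_ennreal hC).mul ?_, ?_⟩
  · exact Measurable.lintegral_kernel_prod_right' (κ := h.normalizedKernel hC)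
      (f := fun q : Ω × E => k (q.2, X q.1)) (by fun_prop)
  · filter_upwards [h.ae_count_lt_top hC hΛ] with ω hω
    exact h.setLIntegral_eq_mul_normalizedKernel hC hω _

/-- A Campbell formula: the points of the process in `C` are independent of the sum over the
process of a function that vanishes on `C`. -/
lemma lintegral_setLIntegral [SigmaFinite Λ] (h : IsPoissonPointProcess Φ Λ μ) {C : Set E}
    (hC : MeasurableSet C) (hΛ : Λ C ≠ ∞) {f : E → ℝ≥0∞} (hf : Measurable f)
    (hfC : ∀ z ∈ C, f z = 0) {k : E × ℝ≥0∞ → ℝ≥0∞} (hk : Measurable k) :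
    ∫⁻ ω, ∫⁻ z in C, k (z, ∫⁻ w, f w ∂pointMeasure (Φ ω)) ∂pointMeasure (Φ ω) ∂μ
      = ∫⁻ z in C, ∫⁻ ω, k (z, ∫⁻ w, f w ∂pointMeasure (Φ ω)) ∂μ ∂Λ := by
  set X : Ω → ℝ≥0∞ := fun ω => ∫⁻ w, f w ∂pointMeasure (Φ ω)
  have hX : Measurable X := h.measurable_lintegral hf
  have hN : Measurable fun ω => pointMeasure (Φ ω) C := h.measurable_count_ennreal hC
  have hfinK := h.isFiniteKernel_normalizedKernel hC
  set κ := h.normalizedKernel hC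
  have hfinW : IsFiniteMeasure (μ.withDensity fun ω => pointMeasure (Φ ω) C) :=
    isFiniteMeasure_withDensity (by rwa [h.lintegral_count hC hΛ])
  have hsw : Measurable fun q : Ω × E => (q.2, X q.1) := by fun_prop
  have hform : ∀ k : E × ℝ≥0∞ → ℝ≥0∞, Measurable k →
      ∫⁻ q, k q ∂(((μ.withDensity fun ω => pointMeasure (Φ ω) C) ⊗ₘ κ).map
        fun q : Ω × E => (q.2, X q.1))
      = ∫⁻ ω, ∫⁻ z in C, k (z, X ω) ∂pointMeasure (Φ ω) ∂μ := fun k hk => by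
    have hm : Measurable fun q : Ω × E => k (q.2, X q.1) := hk.comp hsw
    rw [lintegral_map hk hsw, Measure.lintegral_compProd hm,
      lintegral_withDensity_eq_lintegral_mul _ hN]
    · refine lintegral_congr_ae ?_
      filter_upwards [h.ae_count_lt_top hC hΛ] with ω hω
      rw [h.setLIntegral_eq_mul_normalizedKernel hC hω]
      rfl
    · exact Measurable.lintegral_kernel_prod_right' (κ := κ) hm
  have hfinC : IsFiniteMeasure (Λ.restrict C) := ⟨by rwa [Measure.restrict_apply_univ, lt_top_iff_ne_top]⟩
  have hfinX : IsProbabilityMeasure (μ.map X) := Measure.isProbabilityMeasure_map hX.aemeasurable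
  -- The law of the pair (point, `X`), weighted by the count, is a product measure. It suffices to
  -- test rectangles, where the claim is the independence of `X` and the count in `B ∩ C`.
  have hprod : (Λ.restrict C).prod (μ.map X) = ((μ.withDensity fun ω => pointMeasure (Φ ω) C) ⊗ₘ κ).map
        fun q : Ω × E => (q.2, X q.1) := by
    refine Measure.prod_eq fun B T hB hT => ?_
    have h1 := hform ((B ×ˢ T).indicator 1) (measurable_one.indicator (hB.prod hT))
    rw [lintegral_indicator_one (hB.prod hT)] at h1
    rw [h1, Measure.restrict_apply hB, Measure.map_apply hX hT]
    have h2 : ∀ ω, ∫⁻ z in C, (B ×ˢ T).indicator (1 : E × ℝ≥0∞ → ℝ≥0∞) (z, X ω) ∂pointMeasure (Φ ω)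
        = (X ⁻¹' T).indicator 1 ω * pointMeasure (Φ ω) (B ∩ C) := fun ω => by
      by_cases hω : X ω ∈ T
      · have : ∀ z, (B ×ˢ T).indicator (1 : E × ℝ≥0∞ → ℝ≥0∞) (z, X ω) = B.indicator 1 z := fun z => by
          by_cases hz : z ∈ B <;> simp [hz, hω]
        simp only [this]
        rw [lintegral_indicator_one hB, Measure.restrict_apply hB, indicator_of_mem (show ω ∈ X ⁻¹' T from hω),
          Pi.one_apply, one_mul]
      · simp [hω]
    simp only [h2]
    have hBC : Λ (B ∩ C) ≠ ∞ := ((measure_mono inter_subset_right).trans_lt hΛ.lt_top).ne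
    have hind := (h.indepFun_count_lintegral (hB.inter hC) hf (fun z hz => hfC z hz.2)).comp
      (φ := T.indicator (1 : ℝ≥0∞ → ℝ≥0∞)) (ψ := id) (measurable_one.indicator hT) measurable_id
    have h3 := lintegral_mul_eq_lintegral_mul_lintegral_of_indepFun
      ((measurable_one.indicator hT).comp hX) (h.measurable_count_ennreal (hB.inter hC)) hind
    rw [mul_comm]
    refine h3.trans ?_
    congr 1
    · rw [← lintegral_indicator_one (hX hT)]
      rfl
    · exact h.lintegral_count (hB.inter hC) hBC
  rw [← hform k hk, ← hprod, lintegral_prod _ hk.aemeasurable]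
  refine lintegral_congr fun z => ?_
  rw [lintegral_map (by fun_prop) hX]

end IsPoissonPointProcess

end Campbell

/-! ### Service by the strongest point -/

section Ordered

variable {E T : Type*} [LinearOrder T]

/-- The power `r w` of the points `w` whose level `κ (p w)` is less than `t`; it is infinite at
points of level greater than `t` and zero at points of level `t`. -/
noncomputable def powerBelow (κ : ℝ → T) (p : E → ℝ) (r : E → ℝ≥0∞) (t : T) (w : E) : ℝ≥0∞ :=
  if t < κ (p w) then ∞ else if κ (p w) < t then r w else 0

lemma powerBelow_of_eq {κ : ℝ → T} {p : E → ℝ} {r : E → ℝ≥0∞} {t : T} {w : E} (h : κ (p w) = t) :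
    powerBelow κ p r t w = 0 := by
  simp [powerBelow, h]

lemma powerBelow_of_lt {κ : ℝ → T} {p : E → ℝ} {r : E → ℝ≥0∞} {t : T} {w : E} (h : κ (p w) < t) :
    powerBelow κ p r t w = r w := by
  simp [powerBelow, h, h.le]

lemma powerBelow_of_gt {κ : ℝ → T} {p : E → ℝ} {r : E → ℝ≥0∞} {t : T} {w : E} (h : t < κ (p w)) :
    powerBelow κ p r t w = ∞ := by
  simp [powerBelow, h]

lemma measurable_powerBelow [MeasurableSpace E] [TopologicalSpace T] [OrderClosedTopology T]
    [SecondCountableTopology T] [MeasurableSpace T] [BorelSpace T]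
    {κ : ℝ → T} (hκ : Measurable κ) {p : E → ℝ} (hp : Measurable p) {r : E → ℝ≥0∞}
    (hr : Measurable r) (t : T) : Measurable (powerBelow κ p r t) := by
  refine Measurable.ite (measurableSet_lt measurable_const (hκ.comp hp)) measurable_const ?_
  exact Measurable.ite (measurableSet_lt (hκ.comp hp) measurable_const) hr measurable_const

/-- The quantization of the real line with step `1 / n`. -/
noncomputable def quantize (n : ℕ) (x : ℝ) : ℕ := ⌊n * x⌋₊

lemma measurable_quantize (n : ℕ) : Measurable (quantize n) :=
  Nat.measurable_floor.comp (measurable_const_mul _)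

/-- Values at distance at least `1 / n` fall in different cells. -/
lemma quantize_lt {n : ℕ} {x y : ℝ} (hx : 0 ≤ x) (h : 1 ≤ n * (y - x)) :
    quantize n x < quantize n y := by
  unfold quantize
  rw [Nat.lt_iff_add_one_le]
  refine Nat.le_floor ?_
  have := Nat.floor_le (show 0 ≤ n * x by positivity)
  push_cast
  linarith [mul_sub (n : ℝ) y x]

lemma eventually_one_le_mul {d : ℝ} (hd : 0 < d) : ∀ᶠ n : ℕ in atTop, 1 ≤ n * d := by
  filter_upwards [eventually_ge_atTop ⌈1 / d⌉₊] with n hn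
  rw [← div_le_iff₀ hd]
  exact (Nat.le_ceil _).trans (by exact_mod_cast hn)

lemma eventually_quantize_lt {x y : ℝ} (hx : 0 ≤ x) (h : x < y) :
    ∀ᶠ n : ℕ in atTop, quantize n x < quantize n y := by
  filter_upwards [eventually_one_le_mul (sub_pos.2 h)] with n hn using quantize_lt hx hn

lemma eventually_powerBelow_quantize {p : E → ℝ} (hp : ∀ z, 0 < p z) (r : E → ℝ≥0∞) {q : ℝ}
    (hq : 0 < q) (w : E) : ∀ᶠ n : ℕ in atTop,
      powerBelow (quantize n) p r (quantize n q) w = powerBelow id p r q w := by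
  rcases lt_trichotomy (p w) q with h | h | h
  · filter_upwards [eventually_quantize_lt (hp w).le h] with n hn
    rw [powerBelow_of_lt hn, powerBelow_of_lt (by exact h)]
  · refine Eventually.of_forall fun n => ?_
    rw [powerBelow_of_eq (by rw [h]), powerBelow_of_eq (by exact h)]
  · filter_upwards [eventually_quantize_lt hq.le h] with n hn
    rw [powerBelow_of_gt hn, powerBelow_of_gt (by exact h)]

/-- One `n` serves all points: only finitely many have power at least `q / 2`, and the others are
separated from `q` by the uniform gap `q / 2`. -/
lemma eventually_forall_powerBelow_quantize {p : E → ℝ} (hp : ∀ z, 0 < p z) (r : E → ℝ≥0∞) {q : ℝ}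
    (hq : 0 < q) {S : Set E} (hS : (S ∩ {w | q / 2 ≤ p w}).Finite) : ∀ᶠ n : ℕ in atTop, ∀ w ∈ S,
      powerBelow (quantize n) p r (quantize n q) w = powerBelow id p r q w := by
  have h1 : ∀ᶠ n : ℕ in atTop, ∀ w ∈ S ∩ {w | q / 2 ≤ p w},
      powerBelow (quantize n) p r (quantize n q) w = powerBelow id p r q w :=
    (eventually_all_finite hS).2 fun w _ => eventually_powerBelow_quantize hp r hq w
  filter_upwards [h1, eventually_one_le_mul (half_pos hq)] with n hn hn2 w hw
  by_cases h : q / 2 ≤ p w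
  · exact hn w ⟨hw, h⟩
  · rw [not_le] at h
    have : quantize n (p w) < quantize n q := by
      refine quantize_lt (hp w).le (hn2.trans ?_)
      gcongr
      linarith
    rw [powerBelow_of_lt this, powerBelow_of_lt (show id (p w) < q by simp only [id]; linarith)]

end Ordered

/-! ### The served point as a threshold event on the power below its level -/

section Success

variable {E : Type*} [MeasurableSpace E]

/-- The power `r z` exceeds `β` times the sum of the noise `ν` and of the powers of the points of
`S` of level less than `t`, and no point of `S` has a level greater than `t`. -/
def Exceeds {T : Type*} [LinearOrder T] (κ : ℝ → T) (p : E → ℝ) (r : E → ℝ≥0∞) (β ν : ℝ≥0∞)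
    (S : Set E) (t : T) (x : ℝ≥0∞) : Prop :=
  β * (∫⁻ w, powerBelow κ p r t w ∂pointMeasure S + ν) < x

/-- `z` is the strongest point of `S`, and its ratio of power to interference plus noise exceeds
`β`. -/
def Served (p : E → ℝ) (r : E → ℝ≥0∞) (β ν : ℝ≥0∞) (S : Set E) (z : E) : Prop :=
  (z ∈ S ∧ ∀ w ∈ S, p w ≤ p z) ∧ β < r z / ((∑' w : ↥(S \ {z}), r w) + ν)

lemma exceeds_id_iff {p : E → ℝ} (hpm : Measurable p) {r : E → ℝ≥0∞} (hrm : Measurable r)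
    {β ν : ℝ≥0∞} (hβ : β ≠ 0) (hβ' : β ≠ ∞)
    {S : Set E} (hS : InjOn p S) {z : E} (hz : z ∈ S) :
    Exceeds id p r β ν S (p z) (r z) ↔ Served p r β ν S z := by
  have hm := measurable_powerBelow (κ := id) measurable_id hpm hrm (p z)
  by_cases hmain : ∀ w ∈ S, p w ≤ p z
  · have hsum : ∫⁻ w, powerBelow id p r (p z) w ∂pointMeasure S = ∑' w : ↥(S \ {z}), r w := by
      rw [lintegral_pointMeasure S hm, tsum_subtype S (powerBelow id p r (p z)),
        tsum_subtype (S \ {z}) r]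
      congr 1
      ext w
      by_cases hw : w ∈ S
      · by_cases hwz : w = z
        · subst hwz
          simp [powerBelow]
        · have hlt : p w < p z := lt_of_le_of_ne (hmain w hw) fun h => hwz (hS hw hz h)
          rw [indicator_of_mem hw, indicator_of_mem (show w ∈ S \ {z} from ⟨hw, hwz⟩),
            powerBelow_of_lt (by exact hlt)]
      · rw [indicator_of_notMem hw, indicator_of_notMem fun h => hw h.1]
    unfold Exceeds Served
    rw [hsum]
    set D := (∑' w : ↥(S \ {z}), r w) + ν
    -- The conventions for `D = 0` and `D = ∞` agree on both sides because `β` is neither `0` nor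
    -- `∞`.
    have hiff : β < r z / D ↔ β * D < r z := by
      by_cases hD : D = ∞
      · rw [hD, ENNReal.div_top, ENNReal.mul_top hβ]
        simp
      by_cases h0 : D = 0
      · rw [h0, mul_zero]
        by_cases hrz : r z = 0
        · simp [hrz]
        · rw [ENNReal.div_zero hrz]
          exact ⟨fun _ => pos_iff_ne_zero.2 hrz, fun _ => hβ'.lt_top⟩
      · exact ENNReal.lt_div_iff_mul_lt (Or.inl h0) (Or.inl hD)
    rw [hiff]
    exact ⟨fun h => ⟨⟨hz, hmain⟩, h⟩, fun h => h.2⟩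
  · refine iff_of_false ?_ fun h => hmain h.1.2
    push Not at hmain
    obtain ⟨w, hw, hlt⟩ := hmain
    -- A stronger point makes the sum infinite, which rules out the threshold event.
    have : ∫⁻ w, powerBelow id p r (p z) w ∂pointMeasure S = ∞ := by
      rw [lintegral_pointMeasure S hm]
      refine ENNReal.tsum_eq_top_of_eq_top ⟨⟨w, hw⟩, powerBelow_of_gt (by exact hlt)⟩
    unfold Exceeds
    rw [this, top_add, ENNReal.mul_top hβ]
    simp

lemma eventually_exceeds_quantize_iff {p : E → ℝ} (hpm : Measurable p) (hp : ∀ z, 0 < p z)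
    {r : E → ℝ≥0∞} (hrm : Measurable r) {β ν : ℝ≥0∞} {S : Set E}
    (hfin : ∀ δ : ℝ, 0 < δ → (S ∩ {w | δ ≤ p w}).Finite) (z : E) :
    ∀ᶠ n : ℕ in atTop, (Exceeds (quantize n) p r β ν S (quantize n (p z)) (r z)
      ↔ Exceeds id p r β ν S (p z) (r z)) := by
  filter_upwards [eventually_forall_powerBelow_quantize hp r (hp z) (hfin _ (half_pos (hp z)))]
    with n hn
  unfold Exceeds
  rw [lintegral_pointMeasure S (measurable_powerBelow (measurable_quantize n) hpm hrm _),
    lintegral_pointMeasure S (measurable_powerBelow measurable_id hpm hrm _)]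
  rw [tsum_congr fun w : S => hn w w.2]

lemma measurableSet_exceeds_quantize {p : E → ℝ} (hpm : Measurable p)
    {r : E → ℝ≥0∞} (hrm : Measurable r) (β ν : ℝ≥0∞) (S : Set E) (n : ℕ) :
    MeasurableSet {z | Exceeds (quantize n) p r β ν S (quantize n (p z)) (r z)} := by
  refine measurableSet_lt (Measurable.const_mul (Measurable.add_const ?_ _) _) hrm
  exact (measurable_from_top (f := fun i : ℕ => ∫⁻ w, powerBelow (quantize n) p r i w
    ∂pointMeasure S)).comp ((measurable_quantize n).comp hpm)

open Classical in
/-- The number of points of `S` of power at least `δ` that exceed the threshold is, for a fine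
enough quantization, the indicator of the existence of a served point. -/
lemma eventually_lintegral_exceeds {p : E → ℝ} (hpm : Measurable p) (hp : ∀ z, 0 < p z)
    {r : E → ℝ≥0∞} (hrm : Measurable r) {β ν : ℝ≥0∞} (hβ : β ≠ 0)
    (hβ' : β ≠ ∞) {S : Set E} (hS : InjOn p S)
    (hfin : ∀ δ : ℝ, 0 < δ → (S ∩ {w | δ ≤ p w}).Finite) {δ : ℝ} (hδ : 0 < δ) :
    ∀ᶠ n : ℕ in atTop, ∫⁻ z in {z | δ ≤ p z},
      {z | Exceeds (quantize n) p r β ν S (quantize n (p z)) (r z)}.indicator 1 z ∂pointMeasure S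
      = if ∃ z, Served p r β ν S z ∧ δ ≤ p z then 1 else 0 := by
  have h1 : ∀ᶠ n : ℕ in atTop, ∀ z ∈ S ∩ {w | δ ≤ p w},
      (Exceeds (quantize n) p r β ν S (quantize n (p z)) (r z)
      ↔ Exceeds id p r β ν S (p z) (r z)) :=
    (eventually_all_finite (hfin δ hδ)).2 fun z _ =>
      eventually_exceeds_quantize_iff hpm hp hrm hfin z
  filter_upwards [h1] with n hn
  rw [restrict_pointMeasure _ (measurableSet_le measurable_const hpm), lintegral_pointMeasure _
    (measurable_one.indicator (measurableSet_exceeds_quantize hpm hrm β ν S n))]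
  have h2 : ∀ z : ↥(S ∩ {w | δ ≤ p w}),
      {z | Exceeds (quantize n) p r β ν S (quantize n (p z)) (r z)}.indicator (1 : E → ℝ≥0∞) z
      = if Served p r β ν S z then 1 else 0 := fun z => by
    have := (hn z z.2).trans (exceeds_id_iff hpm hrm hβ hβ' hS z.2.1)
    simp only [indicator_apply, mem_ofPred_eq, this, Pi.one_apply]
  rw [tsum_congr h2]
  split_ifs with hex
  · obtain ⟨z, hz, hzδ⟩ := hex
    rw [tsum_eq_single (⟨z, hz.1.1, hzδ⟩ : ↥(S ∩ {w | δ ≤ p w})), if_pos hz]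
    intro w hw
    rw [if_neg]
    intro hw'
    -- Two served points are both strongest, so they have equal power and coincide by injectivity.
    refine hw (Subtype.ext (hS w.2.1 hz.1.1 ?_))
    exact le_antisymm (hz.1.2 w w.2.1) (hw'.1.2 z hz.1.1)
  · push Not at hex
    refine ENNReal.tsum_eq_zero.2 fun z => if_neg fun h => ?_
    exact absurd z.2.2 (not_le.2 (hex z h))

end Success

/-! ### The exponential law -/

instance isProbabilityMeasure_expMeasure_one : IsProbabilityMeasure (expMeasure 1) :=
  isProbabilityMeasure_expMeasure one_pos

lemma expMeasure_Ioi {t : ℝ} (ht : 0 ≤ t) : expMeasure 1 (Ioi t) = ENNReal.ofReal (Real.exp (-t)) := by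
  have h1 := cdf_expMeasure_eq one_pos t
  rw [if_pos ht, cdf_eq_real, one_mul] at h1
  have h2 := prob_compl_eq_one_sub (μ := expMeasure 1) (measurableSet_Iic (a := t))
  rw [compl_Iic] at h2
  rw [h2, ← ENNReal.ofReal_toReal (measure_ne_top (expMeasure 1) (Iic t)), ← measureReal_def, h1,
    ← ENNReal.ofReal_one, ← ENNReal.ofReal_sub _ (by linarith [Real.exp_le_one_iff.2 (neg_nonpos.2 ht)])]
  congr 1; ring

lemma expMeasure_lt_ofReal_mul (a : ℝ≥0∞) {q : ℝ} (hq : 0 < q) :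
    expMeasure 1 {g | a < ENNReal.ofReal (g * q)} = expNeg (a / ENNReal.ofReal q) := by
  induction a using ENNReal.recTopCoe with
  | top => simp [expNeg_top, ENNReal.top_div_of_ne_top]
  | coe a =>
    have : {g : ℝ | (a : ℝ≥0∞) < ENNReal.ofReal (g * q)} = Ioi (a / q : ℝ) := by
      ext g
      rw [mem_ofPred_eq, mem_Ioi, ← ENNReal.ofReal_coe_nnreal,
        ENNReal.ofReal_lt_ofReal_iff', div_lt_iff₀ hq]
      exact ⟨fun h => h.1, fun h => ⟨h, a.coe_nonneg.trans_lt h⟩⟩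
    rw [this, expMeasure_Ioi (by positivity), ← ENNReal.ofReal_coe_nnreal (p := a),
      ← ENNReal.ofReal_div_of_pos hq, expNeg_ofReal (by positivity)]

lemma lintegral_ofReal_expMeasure : ∫⁻ g, ENNReal.ofReal g ∂expMeasure 1 = 1 := by
  have h1 := lintegral_eq_lintegral_meas_lt (expMeasure 1) (f := fun g : ℝ => max g 0)
    (Eventually.of_forall fun g => le_max_right _ _) (by fun_prop)
  have h2 : ∀ g : ℝ, ENNReal.ofReal (max g 0) = ENNReal.ofReal g := fun g => by
    rcases le_total g 0 with h | h
    · rw [max_eq_right h, ENNReal.ofReal_of_nonpos h, ENNReal.ofReal_zero]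
    · rw [max_eq_left h]
  simp only [h2] at h1
  rw [h1]
  have h3 : ∫⁻ t in Ioi (0 : ℝ), expMeasure 1 {g | t < max g 0}
      = ∫⁻ t in Ioi (0 : ℝ), ENNReal.ofReal (Real.exp (-t)) := by
    refine setLIntegral_congr_fun measurableSet_Ioi fun t ht => ?_
    have : {g : ℝ | t < max g 0} = Ioi t := by
      ext g
      simp [not_lt.2 (le_of_lt (show (0 : ℝ) < t from ht))]
    simp only [this, expMeasure_Ioi (le_of_lt ht)]
  rw [h3, ← ofReal_integral_eq_lintegral_ofReal (integrableOn_exp_neg_Ioi 0)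
    (Eventually.of_forall fun t => (Real.exp_pos _).le), integral_exp_neg_Ioi_zero, ENNReal.ofReal_one]

/-! ### Success probability of a Poisson point process of powers -/

/-- The points of average power at least `δ` in the `i`-th quantization cell. -/
def powerCell {E : Type*} (p : E → ℝ) (δ : ℝ) (n i : ℕ) : Set E := {z | δ ≤ p z ∧ quantize n (p z) = i}

lemma powerCell_subset {E : Type*} (p : E → ℝ) (δ : ℝ) (n i : ℕ) : powerCell p δ n i ⊆ {z | δ ≤ p z} :=
  fun _ hz => hz.1

section Model

variable {Ω E : Type*} [MeasurableSpace Ω] [MeasurableSpace E]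

/-- The points of intensity `Λ` have a positive average power `p`, of finite total and without
atoms, and a power `r` that is `p` times an independent exponential variable of mean one. -/
structure IsRayleighModel (p : E → ℝ) (r : E → ℝ≥0∞) (Λ : Measure E) : Prop where
  measurable_avg : Measurable p
  avg_pos : ∀ z, 0 < p z
  measurable_power : Measurable r
  lintegral_avg : ∫⁻ z, ENNReal.ofReal (p z) ∂Λ ≠ ∞
  measure_level : ∀ c, Λ {z | p z = c} = 0
  fading : ∀ φ : ℝ × ℝ≥0∞ → ℝ≥0∞, Measurable φ → ∫⁻ z, φ (p z, r z) ∂Λ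
    = ∫⁻ z, ∫⁻ g, φ (p z, ENNReal.ofReal (g * p z)) ∂expMeasure 1 ∂Λ

/-- The integral of `1 - exp (-s r)`, with value one for `1 - exp (-s r)` above the level `t`, and
zero at this level. -/
noncomputable def exponentBelow {T : Type*} [LinearOrder T] (κ : ℝ → T) (p : E → ℝ) (r : E → ℝ≥0∞)
    (Λ : Measure E) (s : ℝ≥0∞) (t : T) : ℝ≥0∞ :=
  ∫⁻ w, (1 - expNeg (s * powerBelow κ p r t w)) ∂Λ

/-- The success probability of a served point of average power `q`. -/
noncomputable def servedProb {T : Type*} [LinearOrder T] (κ : ℝ → T) (p : E → ℝ) (r : E → ℝ≥0∞)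
    (Λ : Measure E) (β ν : ℝ≥0∞) (q : ℝ) : ℝ≥0∞ :=
  expNeg (β / ENNReal.ofReal q * ν)
    * expNeg (exponentBelow κ p r Λ (β / ENNReal.ofReal q) (κ q))

variable {p : E → ℝ} {r : E → ℝ≥0∞} {Λ : Measure E}

namespace IsRayleighModel

lemma measurableSet_ge (hM : IsRayleighModel p r Λ) (δ : ℝ) : MeasurableSet {z | δ ≤ p z} :=
  measurableSet_le measurable_const hM.measurable_avg

lemma measure_ge_ne_top (hM : IsRayleighModel p r Λ) {δ : ℝ} (hδ : 0 < δ) :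
    Λ {z | δ ≤ p z} ≠ ∞ := by
  have := meas_ge_le_lintegral_div (μ := Λ) (f := fun z => ENNReal.ofReal (p z))
    hM.measurable_avg.ennreal_ofReal.aemeasurable (ε := ENNReal.ofReal δ) (by simpa using hδ) (by simp)
  refine ((measure_mono ?_).trans_lt (this.trans_lt (ENNReal.div_lt_top hM.lintegral_avg
    (by simpa using hδ)))).ne
  exact fun z hz => ENNReal.ofReal_le_ofReal hz

/-- By Markov's inequality the sets `p ≥ 1/(n+1)` have finite intensity, and they exhaust the space
since `p > 0`. -/
lemma sigmaFinite (hM : IsRayleighModel p r Λ) : SigmaFinite Λ := by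
  refine ⟨⟨⟨fun n => {z | 1 / ((n : ℝ) + 1) ≤ p z}, fun _ => trivial, fun n => ?_, ?_⟩⟩⟩
  · exact (hM.measure_ge_ne_top (by positivity)).lt_top
  · refine eq_univ_of_forall fun z => mem_iUnion.2 ?_
    obtain ⟨n, hn⟩ := exists_nat_one_div_lt (hM.avg_pos z)
    exact ⟨n, hn.le⟩

lemma lintegral_power (hM : IsRayleighModel p r Λ) : ∫⁻ z, r z ∂Λ ≠ ∞ := by
  rw [hM.fading Prod.snd measurable_snd]
  convert hM.lintegral_avg using 2
  ext z
  simp only [ENNReal.ofReal_mul' (hM.avg_pos z).le]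
  rw [lintegral_mul_const _ (by fun_prop), lintegral_ofReal_expMeasure, one_mul]

lemma tendsto_exponentBelow (hM : IsRayleighModel p r Λ) {s : ℝ≥0∞} (hs : s ≠ ∞) {q : ℝ}
    (hq : 0 < q) :
    Tendsto (fun n : ℕ => exponentBelow (quantize n) p r Λ s (quantize n q)) atTop
      (𝓝 (exponentBelow id p r Λ s q)) := by
  refine tendsto_lintegral_filter_of_dominated_convergence
    -- The first summand is at least `1` where `p ≥ q/2`. Elsewhere the point is eventually below
    -- the level of `q`, and `1 - exp(-x) ≤ x` gives the second.
    (fun w => ENNReal.ofReal (2 / q) * ENNReal.ofReal (p w) + s * r w) ?_ ?_ ?_ ?_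
  · exact Eventually.of_forall fun n => measurable_const.sub (measurable_expNeg.comp
      ((measurable_powerBelow (measurable_quantize n) hM.measurable_avg hM.measurable_power
        _).const_mul _))
  · filter_upwards [eventually_one_le_mul (half_pos hq)] with n hn
    refine Eventually.of_forall fun w => ?_
    by_cases h : q / 2 ≤ p w
    · refine le_add_right (tsub_le_self.trans ?_)
      rw [← ENNReal.ofReal_mul (by positivity), ← ENNReal.ofReal_one]
      refine ENNReal.ofReal_le_ofReal ?_
      rw [div_mul_eq_mul_div, le_div_iff₀ hq]
      linarith
    · rw [not_le] at h
      have : quantize n (p w) < quantize n q := by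
        refine quantize_lt (hM.avg_pos w).le (hn.trans ?_)
        gcongr
        linarith
      rw [powerBelow_of_lt this]
      exact le_add_left (one_sub_expNeg_le _)
  · rw [lintegral_add_left (hM.measurable_avg.ennreal_ofReal.const_mul _),
      lintegral_const_mul _ hM.measurable_avg.ennreal_ofReal,
      lintegral_const_mul _ hM.measurable_power]
    exact ENNReal.add_ne_top.2 ⟨ENNReal.mul_ne_top (by simp) hM.lintegral_avg,
      ENNReal.mul_ne_top hs hM.lintegral_power⟩
  · refine Eventually.of_forall fun w => tendsto_const_nhds.congr' ?_
    filter_upwards [eventually_powerBelow_quantize hM.avg_pos r hq w] with n hn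
    rw [hn]

lemma exponentBelow_ne_top (hM : IsRayleighModel p r Λ) {s : ℝ≥0∞} (hs : s ≠ ∞) {q : ℝ}
    (hq : 0 < q) : exponentBelow id p r Λ s q ≠ ∞ := by
  refine ((lintegral_mono (g := fun w => ENNReal.ofReal (1 / q) * ENNReal.ofReal (p w) + s * r w)
    fun w => ?_).trans_lt ?_).ne
  · by_cases h : q ≤ p w
    · refine le_add_right (tsub_le_self.trans ?_)
      rw [← ENNReal.ofReal_mul (by positivity), ← ENNReal.ofReal_one]
      refine ENNReal.ofReal_le_ofReal ?_
      rw [div_mul_eq_mul_div, le_div_iff₀ hq]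
      linarith
    · dsimp only
      rw [powerBelow_of_lt (show id (p w) < q from not_le.1 h)]
      exact le_add_left (one_sub_expNeg_le _)
  · rw [lintegral_add_left (hM.measurable_avg.ennreal_ofReal.const_mul _),
      lintegral_const_mul _ hM.measurable_avg.ennreal_ofReal,
      lintegral_const_mul _ hM.measurable_power, lt_top_iff_ne_top]
    exact ENNReal.add_ne_top.2 ⟨ENNReal.mul_ne_top (by simp) hM.lintegral_avg,
      ENNReal.mul_ne_top hs hM.lintegral_power⟩

end IsRayleighModel

lemma measurableSet_powerCell (hp : Measurable p) (δ : ℝ) (n i : ℕ) :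
    MeasurableSet (powerCell p δ n i) :=
  (measurableSet_le measurable_const hp).inter
    (((measurable_quantize n).comp hp) (measurableSet_singleton i))

lemma setLIntegral_eq_tsum_powerCell (hp : Measurable p) (δ : ℝ) (n : ℕ) (M : Measure E)
    (g : E → ℝ≥0∞) : ∫⁻ z in {z | δ ≤ p z}, g z ∂M = ∑' i, ∫⁻ z in powerCell p δ n i, g z ∂M := by
  have : {z | δ ≤ p z} = ⋃ i, powerCell p δ n i := by
    ext z; simp [powerCell]
  rw [this, lintegral_iUnion (measurableSet_powerCell hp δ n)]
  intro i j hij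
  refine Set.disjoint_left.2 fun z hz hz' => hij (hz.2.symm.trans hz'.2)

variable {Φ : Ω → Set E} {μ : Measure Ω} [IsProbabilityMeasure μ]

/-- Fubini and the exponential tail: averaging the success event over the server's fading turns it
into a Laplace transform of the interference. -/
lemma lintegral_measure_lt_ofReal_mul {X : Ω → ℝ≥0∞} (hX : Measurable X) {q : ℝ} (hq : 0 < q) :
    ∫⁻ g, μ {ω | X ω < ENNReal.ofReal (g * q)} ∂expMeasure 1
      = ∫⁻ ω, expNeg (X ω / ENNReal.ofReal q) ∂μ := by
  have hS : MeasurableSet {x : ℝ × Ω | X x.2 < ENNReal.ofReal (x.1 * q)} :=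
    measurableSet_lt (by fun_prop) (by fun_prop)
  have h1 := Measure.prod_apply (μ := expMeasure 1) (ν := μ) hS
  rw [Measure.prod_apply_symm hS] at h1
  refine h1.symm.trans (lintegral_congr fun ω => ?_)
  exact expMeasure_lt_ofReal_mul (X ω) hq

namespace IsRayleighModel

/-- On a cell the level is constant and the interference vanishes on the cell, so Campbell applies
cell by cell. Averaging over the fading and then the Laplace functional give `servedProb`. -/
lemma lintegral_exceeds_quantize (hM : IsRayleighModel p r Λ) (h : IsPoissonPointProcess Φ Λ μ)
    (β ν : ℝ≥0∞) {δ : ℝ} (hδ : 0 < δ) (n : ℕ) :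
    AEMeasurable (fun ω => ∫⁻ z in {z | δ ≤ p z},
      {z | Exceeds (quantize n) p r β ν (Φ ω) (quantize n (p z)) (r z)}.indicator 1 z
        ∂pointMeasure (Φ ω)) μ ∧
    ∫⁻ ω, ∫⁻ z in {z | δ ≤ p z},
      {z | Exceeds (quantize n) p r β ν (Φ ω) (quantize n (p z)) (r z)}.indicator 1 z
        ∂pointMeasure (Φ ω) ∂μ
      = ∫⁻ z in {z | δ ≤ p z}, servedProb (quantize n) p r Λ β ν (p z) ∂Λ := by
  have := hM.sigmaFinite
  have hpm := hM.measurable_avg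
  have hrm := hM.measurable_power
  have hf : ∀ i, Measurable (powerBelow (quantize n) p r i) := fun i =>
    measurable_powerBelow (measurable_quantize n) hpm hrm i
  set X : ℕ → Ω → ℝ≥0∞ := fun i ω => ∫⁻ w, powerBelow (quantize n) p r i w ∂pointMeasure (Φ ω)
  have hX : ∀ i, Measurable (X i) := fun i => h.measurable_lintegral (hf i)
  let k : E × ℝ≥0∞ → ℝ≥0∞ := {q : E × ℝ≥0∞ | β * (q.2 + ν) < r q.1}.indicator 1
  have hk : Measurable k := measurable_one.indicator
    (measurableSet_lt (by fun_prop) (hrm.comp measurable_fst))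
  have hcell : ∀ ω i, ∫⁻ z in powerCell p δ n i,
      {z | Exceeds (quantize n) p r β ν (Φ ω) (quantize n (p z)) (r z)}.indicator 1 z
        ∂pointMeasure (Φ ω) = ∫⁻ z in powerCell p δ n i, k (z, X i ω) ∂pointMeasure (Φ ω) :=
    fun ω i => by
      refine setLIntegral_congr_fun (measurableSet_powerCell hpm δ n i) fun z hz => ?_
      simp only [k, indicator_apply, mem_ofPred_eq, Exceeds, hz.2, X, Pi.one_apply]
  have hC : ∀ i, Λ (powerCell p δ n i) ≠ ∞ := fun i =>
    ((measure_mono (powerCell_subset p δ n i)).trans_lt (hM.measure_ge_ne_top hδ).lt_top).ne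
  have hae : ∀ i, AEMeasurable (fun ω => ∫⁻ z in powerCell p δ n i, k (z, X i ω)
      ∂pointMeasure (Φ ω)) μ := fun i =>
    h.aemeasurable_setLIntegral (measurableSet_powerCell hpm δ n i) (hC i) hk (hX i)
  simp only [fun ω => setLIntegral_eq_tsum_powerCell hpm δ n (pointMeasure (Φ ω)), hcell]
  refine ⟨AEMeasurable.tsum hae, ?_⟩
  rw [lintegral_tsum hae]
  let ψ : ℕ × ℝ≥0∞ → ℝ≥0∞ := fun q => μ {ω | β * (X q.1 ω + ν) < q.2}
  let φ : ℝ × ℝ≥0∞ → ℝ≥0∞ := fun q => ψ (quantize n q.1, q.2)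
  have hφ : Measurable φ := by
    -- Monotone in the threshold; joint measurability then follows because the levels are countable.
    have h1 : ∀ i, Measurable fun x : ℝ≥0∞ => μ {ω | β * (X i ω + ν) < x} := fun i =>
      Monotone.measurable fun x y hxy => measure_mono fun ω hω => lt_of_lt_of_le hω hxy
    have h2 : Measurable ψ := measurable_from_prod_countable_right h1
    exact h2.comp (((measurable_quantize n).comp measurable_fst).prodMk measurable_snd)
  have hcampbell : ∀ i, ∫⁻ ω, ∫⁻ z in powerCell p δ n i, k (z, X i ω) ∂pointMeasure (Φ ω) ∂μ
      = ∫⁻ z in powerCell p δ n i, φ (p z, r z) ∂Λ := fun i => by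
    rw [h.lintegral_setLIntegral (measurableSet_powerCell hpm δ n i) (hC i) (hf i)
      (fun z hz => powerBelow_of_eq hz.2) hk]
    refine setLIntegral_congr_fun (measurableSet_powerCell hpm δ n i) fun z hz => ?_
    simp only [φ, ψ, hz.2]
    rw [← lintegral_indicator_one (measurableSet_lt (((hX i).add_const ν).const_mul β)
      measurable_const)]
    rfl
  rw [tsum_congr hcampbell, ← setLIntegral_eq_tsum_powerCell hpm]
  have hδm := hM.measurableSet_ge δ
  rw [← lintegral_indicator hδm]
  have hfad := hM.fading ({q : ℝ × ℝ≥0∞ | δ ≤ q.1}.indicator φ)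
    (hφ.indicator (measurableSet_le measurable_const measurable_fst))
  refine Eq.trans ?_ (hfad.trans ?_)
  · refine lintegral_congr fun z => ?_
    simp only [indicator_apply, mem_ofPred_eq]
  rw [← lintegral_indicator hδm]
  refine lintegral_congr fun z => ?_
  by_cases hz : δ ≤ p z
  swap
  · simp [hz]
  simp only [indicator_apply, mem_ofPred_eq, hz, if_true, φ, ψ]
  have hq := hM.avg_pos z
  rw [lintegral_measure_lt_ofReal_mul (X := fun ω => β * (X (quantize n (p z)) ω + ν))
    (((hX _).add_const ν).const_mul β) hq]
  set s := β / ENNReal.ofReal (p z) with hs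
  have h3 : ∀ ω, expNeg (β * (X (quantize n (p z)) ω + ν) / ENNReal.ofReal (p z))
      = expNeg (s * ν) * expNeg (∫⁻ w, s * powerBelow (quantize n) p r (quantize n (p z)) w
        ∂pointMeasure (Φ ω)) := fun ω => by
    rw [lintegral_const_mul _ (hf _), ← expNeg_add, hs]
    congr 1
    rw [div_eq_mul_inv, div_eq_mul_inv]
    ring
  simp only [h3]
  rw [lintegral_const_mul' _ _ (expNeg_ne_top _),
    h.laplace ((hf _).const_mul s)]
  rfl

/-- The indicators of the cells of `q` tend to zero off the level set `p = q`, which is null. -/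
lemma tendsto_measure_powerCell (hM : IsRayleighModel p r Λ) {δ : ℝ} (hδ : 0 < δ) {q : ℝ}
    (hq : 0 ≤ q) : Tendsto (fun n => Λ (powerCell p δ n (quantize n q))) atTop (𝓝 0) := by
  have hC := fun n => measurableSet_powerCell hM.measurable_avg δ n (quantize n q)
  have : Tendsto (fun n => ∫⁻ w, (powerCell p δ n (quantize n q)).indicator 1 w ∂Λ) atTop
      (𝓝 (∫⁻ w, 0 ∂Λ)) := by
    refine tendsto_lintegral_of_dominated_convergence ({z | δ ≤ p z}.indicator 1)
      (fun n => measurable_one.indicator (hC n))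
      (fun n => Eventually.of_forall fun w =>
        indicator_le_indicator_of_subset (powerCell_subset p δ n _) (fun _ => zero_le) w) ?_ ?_
    · rw [lintegral_indicator_one (hM.measurableSet_ge δ)]
      exact hM.measure_ge_ne_top hδ
    · have : ∀ᵐ w ∂Λ, p w ≠ q := by
        rw [ae_iff]
        simpa using hM.measure_level q
      filter_upwards [this] with w hw
      refine tendsto_const_nhds.congr' ?_
      have hne : ∀ᶠ n in atTop, quantize n (p w) ≠ quantize n q := by
        rcases lt_or_gt_of_ne hw with h | h
        · filter_upwards [eventually_quantize_lt (hM.avg_pos w).le h] with n hn using hn.ne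
        · filter_upwards [eventually_quantize_lt hq h] with n hn using hn.ne'
      filter_upwards [hne] with n hn
      rw [indicator_of_notMem fun h => hn h.2]
  simpa only [lintegral_indicator_one (hC _), lintegral_zero] using this

/-- Almost surely no two points of the process have the same average power. -/
lemma ae_injOn (hM : IsRayleighModel p r Λ) (h : IsPoissonPointProcess Φ Λ μ) :
    ∀ᵐ ω ∂μ, InjOn p (Φ ω) := by
  have key : ∀ δ : ℝ, 0 < δ → ∀ᵐ ω ∂μ, InjOn p (Φ ω ∩ {z | δ ≤ p z}) := fun δ hδ => by
    have hC := measurableSet_powerCell hM.measurable_avg δ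
    have hCfin : ∀ n i, Λ (powerCell p δ n i) ≠ ∞ := fun n i =>
      ((measure_mono (powerCell_subset p δ n i)).trans_lt (hM.measure_ge_ne_top hδ).lt_top).ne
    have hle : ∀ n, μ {ω | ¬ InjOn p (Φ ω ∩ {z | δ ≤ p z})}
        ≤ ∫⁻ z in {z | δ ≤ p z}, Λ (powerCell p δ n (quantize n (p z))) ∂Λ := fun n => by
      have hsub : {ω | ¬ InjOn p (Φ ω ∩ {z | δ ≤ p z})}
          ⊆ ⋃ i, {ω | 2 ≤ pointMeasure (Φ ω) (powerCell p δ n i)} := fun ω hω => by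
        simp only [InjOn, mem_ofPred_eq, not_forall] at hω
        obtain ⟨z, hz, w, hw, hzw, hne⟩ := hω
        refine mem_iUnion.2 ⟨quantize n (p z), ?_⟩
        rw [mem_ofPred_eq, pointMeasure_apply _ (hC n _)]
        have : ({z, w} : Set E) ⊆ Φ ω ∩ powerCell p δ n (quantize n (p z)) := by
          rintro _ (rfl | rfl)
          · exact ⟨hz.1, hz.2, rfl⟩
          · exact ⟨hw.1, hw.2, by rw [hzw]⟩
        have := encard_le_encard this
        rw [encard_pair hne] at this
        exact_mod_cast this
      refine (measure_mono hsub).trans ((measure_iUnion_le _).trans ?_)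
      -- The sum of the squared cell masses is the integral of the mass of the cell containing `z`,
      -- which tends to zero by domination.
      rw [setLIntegral_eq_tsum_powerCell hM.measurable_avg δ n]
      refine ENNReal.tsum_le_tsum fun i => (h.measure_two_le_count (hC n i) (hCfin n i)).trans ?_
      rw [setLIntegral_congr_fun (hC n i) (g := fun _ => Λ (powerCell p δ n i))
        fun z hz => by simp only [hz.2], setLIntegral_const, sq]
    have hlim : Tendsto (fun n => ∫⁻ z in {z | δ ≤ p z},
        Λ (powerCell p δ n (quantize n (p z))) ∂Λ) atTop (𝓝 (∫⁻ z in {z | δ ≤ p z}, 0 ∂Λ)) := by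
      refine tendsto_lintegral_of_dominated_convergence (fun _ => Λ {z | δ ≤ p z}) (fun n => ?_)
        (fun n => Eventually.of_forall fun z => measure_mono (powerCell_subset p δ n _)) ?_
        (Eventually.of_forall fun z => hM.tendsto_measure_powerCell hδ (hM.avg_pos z).le)
      · exact (measurable_from_top (f := fun i => Λ (powerCell p δ n i))).comp
          ((measurable_quantize n).comp hM.measurable_avg)
      · rw [lintegral_const, Measure.restrict_apply_univ]
        exact ENNReal.mul_ne_top (hM.measure_ge_ne_top hδ) (hM.measure_ge_ne_top hδ)
    rw [lintegral_zero] at hlim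
    exact le_antisymm (ge_of_tendsto' hlim hle) zero_le
  have := ae_all_iff.2 fun n : ℕ => key (1 / ((n : ℝ) + 1)) (by positivity)
  filter_upwards [this] with ω hω z hz w hw hzw
  obtain ⟨n, hn⟩ := exists_nat_one_div_lt (hM.avg_pos z)
  exact hω n ⟨hz, hn.le⟩ ⟨hw, by rw [mem_ofPred_eq, ← hzw]; exact hn.le⟩ hzw

lemma ae_finite (hM : IsRayleighModel p r Λ) (h : IsPoissonPointProcess Φ Λ μ) :
    ∀ᵐ ω ∂μ, ∀ δ : ℝ, 0 < δ → (Φ ω ∩ {z | δ ≤ p z}).Finite := by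
  have := ae_all_iff.2 fun n : ℕ => h.ae_count_lt_top (hM.measurableSet_ge (1 / ((n : ℝ) + 1)))
    (hM.measure_ge_ne_top (by positivity))
  filter_upwards [this] with ω hω δ hδ
  obtain ⟨n, hn⟩ := exists_nat_one_div_lt hδ
  have h1 := hω n
  rw [pointMeasure_apply _ (hM.measurableSet_ge _)] at h1
  have h2 : (Φ ω ∩ {z | 1 / ((n : ℝ) + 1) ≤ p z}).Finite := by
    rw [← encard_lt_top_iff]
    exact_mod_cast h1
  exact h2.subset (inter_subset_inter_right _ fun z hz => hn.le.trans hz)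

lemma tendsto_servedProb (hM : IsRayleighModel p r Λ) {β : ℝ≥0∞} (hβ : β ≠ ∞) (ν : ℝ≥0∞) {q : ℝ}
    (hq : 0 < q) : Tendsto (fun n => servedProb (quantize n) p r Λ β ν q) atTop
      (𝓝 (servedProb id p r Λ β ν q)) := by
  refine ENNReal.Tendsto.const_mul ?_ (Or.inr (expNeg_ne_top _))
  refine (continuous_expNeg.tendsto _).comp (hM.tendsto_exponentBelow ?_ hq)
  exact ENNReal.div_ne_top hβ (by simpa using hq)

lemma servedProb_le_one {T : Type*} [LinearOrder T] (κ : ℝ → T) (p : E → ℝ) (r : E → ℝ≥0∞)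
    (Λ : Measure E) (β ν : ℝ≥0∞) (q : ℝ) : servedProb κ p r Λ β ν q ≤ 1 :=
  mul_le_one' (expNeg_le_one _) (expNeg_le_one _)

lemma measurable_servedProb_quantize (hM : IsRayleighModel p r Λ) (β ν : ℝ≥0∞) (n : ℕ) :
    Measurable fun z => servedProb (quantize n) p r Λ β ν (p z) := by
  have hs : Measurable fun z => β / ENNReal.ofReal (p z) :=
    measurable_const.div hM.measurable_avg.ennreal_ofReal
  refine (measurable_expNeg.comp (hs.mul_const ν)).mul (measurable_expNeg.comp ?_)
  have := hM.sigmaFinite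
  have h1 : ∀ i, Measurable fun s : ℝ≥0∞ => exponentBelow (quantize n) p r Λ s i := fun i => by
    refine Measurable.lintegral_prod_right' (f := fun q : ℝ≥0∞ × E =>
      1 - expNeg (q.1 * powerBelow (quantize n) p r i q.2)) ?_
    exact measurable_const.sub (measurable_expNeg.comp (measurable_fst.mul ((measurable_powerBelow
      (measurable_quantize n) hM.measurable_avg hM.measurable_power i).comp measurable_snd)))
  have h2 : Measurable fun q : ℕ × ℝ≥0∞ => exponentBelow (quantize n) p r Λ q.2 q.1 :=
    measurable_from_prod_countable_right h1
  exact h2.comp (((measurable_quantize n).comp hM.measurable_avg).prodMk hs)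

/-- The level and the scale `β / p z` both vary with `z`; quantization reduces the level to
countably many values, and the limit inherits measurability. -/
lemma measurable_servedProb (hM : IsRayleighModel p r Λ) {β : ℝ≥0∞} (hβ : β ≠ ∞) (ν : ℝ≥0∞) :
    Measurable fun z => servedProb id p r Λ β ν (p z) :=
  measurable_of_tendsto_metrizable (hM.measurable_servedProb_quantize β ν)
    (tendsto_pi_nhds.2 fun z => hM.tendsto_servedProb hβ ν (hM.avg_pos z))

open Classical in
lemma measure_served_ge (hM : IsRayleighModel p r Λ) (h : IsPoissonPointProcess Φ Λ μ)
    {β : ℝ≥0∞} (hβ : β ≠ 0) (hβ' : β ≠ ∞) (ν : ℝ≥0∞) {δ : ℝ} (hδ : 0 < δ) :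
    μ {ω | ∃ z, Served p r β ν (Φ ω) z ∧ δ ≤ p z}
      = ∫⁻ z in {z | δ ≤ p z}, servedProb id p r Λ β ν (p z) ∂Λ := by
  set Y : ℕ → Ω → ℝ≥0∞ := fun n ω => ∫⁻ z in {z | δ ≤ p z},
      {z | Exceeds (quantize n) p r β ν (Φ ω) (quantize n (p z)) (r z)}.indicator 1 z
        ∂pointMeasure (Φ ω)
  set A : Set Ω := {ω | ∃ z, Served p r β ν (Φ ω) z ∧ δ ≤ p z}
  have hY : ∀ n, AEMeasurable (Y n) μ := fun n => (hM.lintegral_exceeds_quantize h β ν hδ n).1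
  have hlimY : ∀ᵐ ω ∂μ, Tendsto (fun n => Y n ω) atTop (𝓝 (A.indicator 1 ω)) := by
    filter_upwards [hM.ae_injOn h, hM.ae_finite h] with ω h1 h2
    refine tendsto_const_nhds.congr' ?_
    filter_upwards [eventually_lintegral_exceeds hM.measurable_avg hM.avg_pos hM.measurable_power
      (ν := ν) hβ hβ' h1 h2 hδ] with n hn
    rw [indicator_apply]
    exact hn.symm
  have hA : AEMeasurable (A.indicator (1 : Ω → ℝ≥0∞)) μ :=
    aemeasurable_of_tendsto_metrizable_ae _ hY hlimY
  -- Existence of a served point is not measurable by definition; its indicator is an a.e. limit of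
  -- measurable functions.
  have hA' : NullMeasurableSet A μ := by
    have := hA.nullMeasurable (measurableSet_singleton (1 : ℝ≥0∞))
    convert this using 1
    ext ω
    by_cases hω : ω ∈ A <;> simp [hω]
  have hL : Tendsto (fun n => ∫⁻ ω, Y n ω ∂μ) atTop (𝓝 (μ A)) := by
    rw [← lintegral_indicator_one₀ hA']
    -- The dominating variable is the number of points of power at least `δ`, whose mean is finite.
    refine tendsto_lintegral_of_dominated_convergence' (fun ω => pointMeasure (Φ ω) {z | δ ≤ p z})
      hY (fun n => Eventually.of_forall fun ω => ?_) ?_ hlimY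
    · refine (lintegral_mono (g := fun _ => 1) fun z => indicator_le_self' (by simp) z).trans ?_
      simp
    · rw [h.lintegral_count (hM.measurableSet_ge δ) (hM.measure_ge_ne_top hδ)]
      exact hM.measure_ge_ne_top hδ
  have hR : Tendsto (fun n => ∫⁻ z in {z | δ ≤ p z}, servedProb (quantize n) p r Λ β ν (p z) ∂Λ)
      atTop (𝓝 (∫⁻ z in {z | δ ≤ p z}, servedProb id p r Λ β ν (p z) ∂Λ)) := by
    refine tendsto_lintegral_of_dominated_convergence (fun _ => 1)
      (hM.measurable_servedProb_quantize β ν)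
      (fun n => Eventually.of_forall fun z => servedProb_le_one _ _ _ _ _ _ _) ?_
      (Eventually.of_forall fun z => hM.tendsto_servedProb hβ' ν (hM.avg_pos z))
    rw [lintegral_const, Measure.restrict_apply_univ, one_mul]
    exact hM.measure_ge_ne_top hδ
  refine tendsto_nhds_unique hL (hR.congr fun n => ?_)
  exact (hM.lintegral_exceeds_quantize h β ν hδ n).2.symm

/-- The success probability of a Poisson point process of powers. -/
theorem measure_served (hM : IsRayleighModel p r Λ) (h : IsPoissonPointProcess Φ Λ μ)
    {β : ℝ≥0∞} (hβ : β ≠ 0) (hβ' : β ≠ ∞) (ν : ℝ≥0∞) :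
    μ {ω | ∃ z, Served p r β ν (Φ ω) z} = ∫⁻ z, servedProb id p r Λ β ν (p z) ∂Λ := by
  have hmono : ∀ m n : ℕ, m ≤ n → (1 / ((n : ℝ) + 1)) ≤ 1 / ((m : ℝ) + 1) := fun m n hmn => by
    gcongr
  have h1 : {ω | ∃ z, Served p r β ν (Φ ω) z}
      = ⋃ n : ℕ, {ω | ∃ z, Served p r β ν (Φ ω) z ∧ 1 / ((n : ℝ) + 1) ≤ p z} := by
    ext ω
    simp only [mem_iUnion, mem_ofPred_eq]
    refine ⟨fun ⟨z, hz⟩ => ?_, fun ⟨n, z, hz, _⟩ => ⟨z, hz⟩⟩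
    obtain ⟨n, hn⟩ := exists_nat_one_div_lt (hM.avg_pos z)
    exact ⟨n, z, hz, hn.le⟩
  have h2 : (univ : Set E) = ⋃ n : ℕ, {z | 1 / ((n : ℝ) + 1) ≤ p z} := by
    refine (eq_univ_of_forall fun z => mem_iUnion.2 ?_).symm
    obtain ⟨n, hn⟩ := exists_nat_one_div_lt (hM.avg_pos z)
    exact ⟨n, hn.le⟩
  have hm2 : Monotone fun n : ℕ => {z | 1 / ((n : ℝ) + 1) ≤ p z} := fun m n hmn z hz =>
    (hmono m n hmn).trans hz
  rw [h1, Monotone.measure_iUnion fun m n hmn ω hω => by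
    obtain ⟨z, hz, hz'⟩ := hω
    exact ⟨z, hz, (hmono m n hmn).trans hz'⟩]
  conv_rhs => rw [← setLIntegral_univ, h2, setLIntegral_iUnion_of_directed _ hm2.directed_le]
  exact iSup_congr fun n => hM.measure_served_ge h hβ hβ' ν (by positivity)

end IsRayleighModel

end Model

/-! ### Superposition and scaling of intensities -/

lemma IsRayleighModel.add {E : Type*} [MeasurableSpace E] {p : E → ℝ} {r : E → ℝ≥0∞}
    {Λ Λ' : Measure E} (h : IsRayleighModel p r Λ) (h' : IsRayleighModel p r Λ') :
    IsRayleighModel p r (Λ + Λ') where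
  measurable_avg := h.measurable_avg
  avg_pos := h.avg_pos
  measurable_power := h.measurable_power
  lintegral_avg := by
    rw [lintegral_add_measure]
    exact ENNReal.add_ne_top.2 ⟨h.lintegral_avg, h'.lintegral_avg⟩
  measure_level c := by
    rw [Measure.add_apply, h.measure_level, h'.measure_level, add_zero]
  fading φ hφ := by
    rw [lintegral_add_measure, lintegral_add_measure, h.fading φ hφ, h'.fading φ hφ]

lemma IsRayleighModel.smul {E : Type*} [MeasurableSpace E] {p : E → ℝ} {r : E → ℝ≥0∞}
    {Λ : Measure E} (h : IsRayleighModel p r Λ) {c : ℝ≥0∞} (hc : c ≠ ∞) :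
    IsRayleighModel p r (c • Λ) where
  measurable_avg := h.measurable_avg
  avg_pos := h.avg_pos
  measurable_power := h.measurable_power
  lintegral_avg := by
    rw [lintegral_smul_measure]
    exact ENNReal.mul_ne_top hc h.lintegral_avg
  measure_level x := by
    rw [Measure.smul_apply, h.measure_level, smul_zero]
  fading φ hφ := by
    rw [lintegral_smul_measure, lintegral_smul_measure, h.fading φ hφ]

lemma IsRayleighModel.sum {E ι : Type*} [MeasurableSpace E] {p : E → ℝ} {r : E → ℝ≥0∞}
    {Λ : ι → Measure E} (hp : Measurable p) (hp0 : ∀ z, 0 < p z) (hr : Measurable r)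
    (s : Finset ι) (h : ∀ i ∈ s, IsRayleighModel p r (Λ i)) :
    IsRayleighModel p r (∑ i ∈ s, Λ i) := by
  classical
  induction s using Finset.induction_on with
  | empty => exact ⟨hp, hp0, hr, by simp, by simp, by simp⟩
  | insert i s hi ih =>
    rw [Finset.sum_insert hi]
    exact (h i (Finset.mem_insert_self i s)).add
      (ih fun j hj => h j (Finset.mem_insert_of_mem hj))

/-! ### Link geometry -/

lemma linkDist_pos {h : ℝ} (hh : 0 < h) (x : Plane) : 0 < linkDist h x :=
  Real.sqrt_pos.2 (by positivity)

lemma le_linkDist (h : ℝ) (x : Plane) : h ≤ linkDist h x :=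
  Real.le_sqrt_of_sq_le (by nlinarith [sq_nonneg ‖x‖])

lemma losProb_pos {a : ℝ} (ha : 0 ≤ a) (b h x : ℝ) : 0 < losProb a b h x := by
  unfold losProb; positivity

lemma losProb_le_one {a : ℝ} (ha : 0 ≤ a) (b h x : ℝ) : losProb a b h x ≤ 1 := by
  unfold losProb
  refine div_le_one_of_le₀ ?_ (by positivity)
  have : 0 ≤ a * Real.exp (-b * (Real.arcsin (h / x) - a)) := by positivity
  linarith

lemma channelProb_nonneg {a : ℝ} (ha : 0 ≤ a) (b h : ℝ) (c : Channel) (x : ℝ) :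
    0 ≤ channelProb a b h c x := by
  cases c
  · exact (losProb_pos ha b h x).le
  · exact sub_nonneg.2 (losProb_le_one ha b h x)

lemma channelProb_le_one {a : ℝ} (ha : 0 ≤ a) (b h : ℝ) (c : Channel) (x : ℝ) :
    channelProb a b h c x ≤ 1 := by
  cases c
  · exact losProb_le_one ha b h x
  · exact sub_le_self _ (losProb_pos ha b h x).le

lemma measurable_losProb (a b h : ℝ) : Measurable (losProb a b h) := by
  unfold losProb
  have : Measurable fun x : ℝ => Real.arcsin (h / x) :=
    Real.measurable_arcsin.comp (measurable_const.div measurable_id)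
  fun_prop

lemma measurable_channelProb (a b h : ℝ) (c : Channel) : Measurable (channelProb a b h c) := by
  cases c
  · exact measurable_losProb a b h
  · exact (measurable_losProb a b h).const_sub 1

lemma measurable_linkDist (h : ℝ) : Measurable (linkDist h) := by
  unfold linkDist; fun_prop

/-- The average power received from a transmitter above `x`. -/
noncomputable def linkPower (α h P : ℝ) (x : Plane) : ℝ := P * linkDist h x ^ (-α)

lemma linkPower_pos {h P : ℝ} (hh : 0 < h) (hP : 0 < P) (α : ℝ) (x : Plane) :
    0 < linkPower α h P x :=
  mul_pos hP (Real.rpow_pos_of_pos (linkDist_pos hh x) _)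

lemma lintegral_linkPower {α h P : ℝ} (hα : 2 < α) (hh : 0 < h) (hP : 0 < P) :
    ∫⁻ x, ENNReal.ofReal (linkPower α h P x) ≠ ∞ := by
  have hint : Integrable fun x : Plane => ((1 : ℝ) + ‖x‖ ^ 2) ^ (-α / 2) :=
    integrable_rpow_neg_one_add_norm_sq (by simpa using hα)
  -- This constant gives `m (1 + ‖x‖²) ≤ ‖x‖² + h²`, reducing to the integrable power of `1 + ‖x‖²`,
  -- where `α > 2` is used.
  set m := min 1 (h ^ 2)
  have hm : 0 < m := lt_min one_pos (by positivity)
  have hint' := hint.const_mul (P * m ^ (-α / 2))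
  refine ((lintegral_mono fun x => ENNReal.ofReal_le_ofReal ?_).trans_lt
    hint'.lintegral_lt_top).ne
  unfold linkPower linkDist
  rw [mul_assoc, Real.sqrt_eq_rpow, ← Real.rpow_mul (by positivity),
    ← Real.mul_rpow hm.le (by positivity)]
  refine mul_le_mul_of_nonneg_left ?_ hP.le
  rw [show 1 / 2 * -α = -α / 2 by ring]
  refine Real.rpow_le_rpow_of_nonpos (by positivity) ?_ (by linarith)
  have h1 : m ≤ 1 := min_le_left _ _
  have h2 : m ≤ h ^ 2 := min_le_right _ _
  nlinarith [sq_nonneg ‖x‖]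

lemma volume_linkPower_eq {α h P : ℝ} (hα : 0 < α) (hh : 0 < h) (hP : 0 < P) (c : ℝ) :
    volume {x | linkPower α h P x = c} = 0 := by
  rcases eq_empty_or_nonempty {x | linkPower α h P x = c} with he | ⟨y, hy⟩
  · rw [he, measure_empty]
  · refine measure_mono_null (fun x hx => ?_) (Measure.addHaar_sphere volume (0 : Plane) ‖y‖)
    rw [mem_sphere_zero_iff_norm]
    have h1 : linkPower α h P x = linkPower α h P y := hx.trans hy.symm
    have h2 := mul_left_cancel₀ hP.ne' h1
    have h3 := Real.rpow_left_injOn (x := -α) (by linarith) (linkDist_pos hh x).le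
      (linkDist_pos hh y).le h2
    unfold linkDist at h3
    rw [Real.sqrt_inj (by positivity) (by positivity)] at h3
    exact (pow_left_inj₀ (norm_nonneg _) (norm_nonneg _) two_ne_zero).1 (by linarith)

/-! ### The intensity of the nodes -/

lemma lintegral_const_expMeasure (c : ℝ≥0∞) : ∫⁻ _, c ∂expMeasure 1 = c := by
  rw [lintegral_const, measure_univ, mul_one]

section Nodes

variable {K : ℕ} {α : Channel → ℝ} {h P : Fin K → ℝ}

lemma measurable_avgPower (α : Channel → ℝ) (h P : Fin K → ℝ) : Measurable (avgPower α h P) := by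
  unfold avgPower linkDist
  have h1 : Measurable fun z : Node K => P z.1 :=
    (Measurable.of_discrete (f := P)).comp measurable_fst
  have h2 : Measurable fun z : Node K => h z.1 :=
    (Measurable.of_discrete (f := h)).comp measurable_fst
  have h3 : Measurable fun z : Node K => α z.2.2.1 :=
    (measurable_from_top (f := α)).comp (by fun_prop)
  fun_prop

lemma measurable_rxPower (α : Channel → ℝ) (h P : Fin K → ℝ) : Measurable (rxPower α h P) := by
  have := measurable_avgPower α h P
  unfold rxPower
  fun_prop

lemma avgPower_pos (α : Channel → ℝ) (hh : ∀ k, 0 < h k) (hP : ∀ k, 0 < P k) (z : Node K) :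
    0 < avgPower α h P z :=
  linkPower_pos (hh z.1) (hP z.1) _ _

lemma lintegral_channelIntensity (a b : ℝ) (h : Fin K → ℝ) (k : Fin K) (c : Channel)
    {φ : Node K → ℝ≥0∞} (hφ : Measurable φ) :
    ∫⁻ z, φ z ∂channelIntensity a b h k c
      = ∫⁻ x, ENNReal.ofReal (channelProb a b (h k) c (linkDist (h k) x))
          * ∫⁻ g, φ (k, x, c, g) ∂expMeasure 1 := by
  have hm : Measurable fun q : Plane × ℝ => ((k, q.1, c, q.2) : Node K) := by fun_prop
  have hρ : Measurable fun x : Plane =>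
      ENNReal.ofReal (channelProb a b (h k) c (linkDist (h k) x)) :=
    ((measurable_channelProb a b (h k) c).comp (measurable_linkDist (h k))).ennreal_ofReal
  have hφm : Measurable fun q : Plane × ℝ => φ (k, q.1, c, q.2) := hφ.comp hm
  unfold channelIntensity
  rw [lintegral_map hφ hm, lintegral_prod _ hφm.aemeasurable,
    lintegral_withDensity_eq_lintegral_mul _ hρ hφm.lintegral_prod_right']
  rfl

lemma isRayleighModel_channelIntensity {a : ℝ} (ha : 0 ≤ a) (b : ℝ) (hα : ∀ c, 2 < α c)
    (hh : ∀ k, 0 < h k) (hP : ∀ k, 0 < P k) (k : Fin K) (c : Channel) :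
    IsRayleighModel (avgPower α h P) (rxPower α h P) (channelIntensity a b h k c) where
  measurable_avg := measurable_avgPower α h P
  avg_pos := avgPower_pos α hh hP
  measurable_power := measurable_rxPower α h P
  lintegral_avg := by
    rw [lintegral_channelIntensity a b h k c (measurable_avgPower α h P).ennreal_ofReal]
    refine ((lintegral_mono fun x => ?_).trans_lt
      (lintegral_linkPower (hα c) (hh k) (hP k)).lt_top).ne
    refine (mul_le_of_le_one_left zero_le
      (ENNReal.ofReal_le_one.2 (channelProb_le_one ha b (h k) c _))).trans ?_
    exact (lintegral_const_expMeasure _).le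
  measure_level q := by
    have hS : MeasurableSet {z : Node K | avgPower α h P z = q} :=
      measurable_avgPower α h P (measurableSet_singleton q)
    rw [← lintegral_indicator_one hS,
      lintegral_channelIntensity a b h k c (measurable_one.indicator hS)]
    refine (lintegral_congr_ae ?_).trans lintegral_zero
    have : ∀ᵐ x, linkPower (α c) (h k) (P k) x ≠ q := by
      rw [ae_iff]
      simpa using volume_linkPower_eq (by linarith [hα c]) (hh k) (hP k) q
    filter_upwards [this] with x hx
    have : ∀ g : ℝ, {z : Node K | avgPower α h P z = q}.indicator (1 : Node K → ℝ≥0∞) (k, x, c, g)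
        = 0 := fun g => indicator_of_notMem (s := {z : Node K | avgPower α h P z = q})
        (fun hz => hx hz) _
    simp [this]
  fading φ hφ := by
    have hp := measurable_avgPower α h P
    have h1 : Measurable fun z : Node K => φ (avgPower α h P z, rxPower α h P z) :=
      hφ.comp (hp.prodMk (measurable_rxPower α h P))
    have h2 : Measurable fun z : Node K => ∫⁻ g, φ (avgPower α h P z,
        ENNReal.ofReal (g * avgPower α h P z)) ∂expMeasure 1 := by
      refine Measurable.lintegral_prod_right' (f := fun q : Node K × ℝ =>
        φ (avgPower α h P q.1, ENNReal.ofReal (q.2 * avgPower α h P q.1))) ?_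
      fun_prop
    rw [lintegral_channelIntensity a b h k c h1, lintegral_channelIntensity a b h k c h2]
    refine lintegral_congr fun x => ?_
    congr 1
    -- On the right the gain stored in the node is a dummy variable, replaced by a fresh exponential
    -- gain.
    exact (lintegral_const_expMeasure _).symm

/-- The intensity of the nodes of layer `k` for unit density. -/
noncomputable def layerIntensity (a b : ℝ) (h : Fin K → ℝ) (k : Fin K) : Measure (Node K) :=
  channelIntensity a b h k .los + channelIntensity a b h k .nlos

lemma isRayleighModel_layerIntensity {a : ℝ} (ha : 0 ≤ a) (b : ℝ) (hα : ∀ c, 2 < α c)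
    (hh : ∀ k, 0 < h k) (hP : ∀ k, 0 < P k) (k : Fin K) :
    IsRayleighModel (avgPower α h P) (rxPower α h P) (layerIntensity a b h k) :=
  (isRayleighModel_channelIntensity ha b hα hh hP k _).add
    (isRayleighModel_channelIntensity ha b hα hh hP k _)

lemma isRayleighModel_sum_layerIntensity {a : ℝ} (ha : 0 ≤ a) (b : ℝ) (hα : ∀ c, 2 < α c)
    (hh : ∀ k, 0 < h k) (hP : ∀ k, 0 < P k) (s : Finset (Fin K)) (lam : Fin K → ℝ) :
    IsRayleighModel (avgPower α h P) (rxPower α h P)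
      (∑ k ∈ s, ENNReal.ofReal (lam k) • layerIntensity a b h k) :=
  IsRayleighModel.sum (measurable_avgPower α h P) (avgPower_pos α hh hP) (measurable_rxPower α h P)
    s fun k _ => (isRayleighModel_layerIntensity ha b hα hh hP k).smul ENNReal.ofReal_ne_top

lemma ae_layerIntensity (a b : ℝ) (h : Fin K → ℝ) (k : Fin K) :
    ∀ᵐ z ∂layerIntensity a b h k, z.1 = k := by
  have hc : ∀ c, ∀ᵐ z ∂channelIntensity a b h k c, z.1 = k := fun c => by
    unfold channelIntensity
    refine (ae_map_iff (by fun_prop) (p := fun z : Node K => z.1 = k)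
      (measurable_fst (measurableSet_singleton k))).2 (Eventually.of_forall fun _ => rfl)
  exact ae_add_measure_iff.2 ⟨hc _, hc _⟩

end Nodes

/-! ### The function `ε` -/

section Eps

variable {a b β h P : ℝ} {α : Channel → ℝ}

/-- `epsIntegrand` divided by the distance: the mean, over the state of the link, of
`1 - 1 / (1 + s * p)` for an average power `p`. -/
noncomputable def meanLoss (a b : ℝ) (α : Channel → ℝ) (h P s x : ℝ) : ℝ :=
  channelProb a b h .los x * (1 - 1 / (1 + s * P * x ^ (-α .los)))
    + channelProb a b h .nlos x * (1 - 1 / (1 + s * P * x ^ (-α .nlos)))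

/-- The two state probabilities sum to one, so the leading `1` splits between them; nonnegativity
becomes visible. -/
lemma epsIntegrand_eq (a b : ℝ) (α : Channel → ℝ) (h P s x : ℝ) :
    epsIntegrand a b α h P s x = x * meanLoss a b α h P s x := by
  unfold epsIntegrand meanLoss
  simp only [channelProb]
  ring

lemma one_sub_one_div_nonneg {u : ℝ} (hu : 0 ≤ u) : 0 ≤ 1 - 1 / (1 + u) :=
  sub_nonneg.2 (div_le_one_of_le₀ (by linarith) (by linarith))

lemma one_sub_one_div_le {u : ℝ} (hu : 0 ≤ u) : 1 - 1 / (1 + u) ≤ u := by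
  rw [sub_le_iff_le_add, ← sub_le_iff_le_add', le_div_iff₀ (by linarith)]
  nlinarith

lemma meanLoss_pos (ha : 0 ≤ a) {s x : ℝ} (hs : 0 < s) (hP : 0 < P) (hx : 0 < x) :
    0 < meanLoss a b α h P s x := by
  have hu : ∀ c, 0 < s * P * x ^ (-α c) := fun c => by positivity
  refine add_pos_of_pos_of_nonneg (mul_pos (losProb_pos ha b h x) ?_)
    (mul_nonneg (channelProb_nonneg ha b h _ x) (one_sub_one_div_nonneg (hu _).le))
  rw [sub_pos, div_lt_one (by linarith [hu .los])]
  linarith [hu .los]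

lemma meanLoss_le (ha : 0 ≤ a) {s x : ℝ} (hs : 0 ≤ s) (hP : 0 ≤ P) (hx : 0 ≤ x) :
    meanLoss a b α h P s x ≤ s * P * x ^ (-α .los) + s * P * x ^ (-α .nlos) := by
  have hu : ∀ c, 0 ≤ s * P * x ^ (-α c) := fun c => by positivity
  have : ∀ c, channelProb a b h c x * (1 - 1 / (1 + s * P * x ^ (-α c))) ≤ s * P * x ^ (-α c) :=
    fun c => (mul_le_of_le_one_left (one_sub_one_div_nonneg (hu c))
      (channelProb_le_one ha b h c x)).trans (one_sub_one_div_le (hu c))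
  exact add_le_add (this _) (this _)

lemma measurable_meanLoss (a b : ℝ) (α : Channel → ℝ) (h P s : ℝ) :
    Measurable (meanLoss a b α h P s) := by
  have h1 := measurable_channelProb a b h .los
  have h2 := measurable_channelProb a b h .nlos
  unfold meanLoss
  fun_prop

lemma integrableOn_epsIntegrand (ha : 0 ≤ a) (hα : ∀ c, 2 < α c) (hh : 0 < h) (hP : 0 < P)
    {s : ℝ} (hs : 0 < s) : IntegrableOn (epsIntegrand a b α h P s) (Ioi h) := by
  have hpow : ∀ c, IntegrableOn (fun x : ℝ => s * P * x ^ (1 - α c)) (Ioi h) := fun c =>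
    (integrableOn_Ioi_rpow_of_lt (by linarith [hα c]) hh).const_mul _
  refine Integrable.mono' ((hpow .los).add (hpow .nlos)) ?_ ?_
  · have := measurable_meanLoss a b α h P s
    simp only [funext (epsIntegrand_eq a b α h P s)]
    exact (measurable_id.mul this).aestronglyMeasurable
  · refine (ae_restrict_iff' measurableSet_Ioi).2 (Eventually.of_forall fun x hx => ?_)
    have hx0 : 0 < x := hh.trans hx
    rw [epsIntegrand_eq, Real.norm_eq_abs,
      abs_of_nonneg (mul_nonneg hx0.le (meanLoss_pos ha hs hP hx0).le)]
    refine (mul_le_mul_of_nonneg_left (meanLoss_le ha hs.le hP.le hx0.le) hx0.le).trans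
      (le_of_eq ?_)
    simp only [Pi.add_apply, sub_eq_add_neg, Real.rpow_add hx0, Real.rpow_one]
    ring

lemma eps_pos (ha : 0 ≤ a) (hα : ∀ c, 2 < α c) (hh : 0 < h) (hP : 0 < P)
    {s : ℝ} (hs : 0 < s) : 0 < eps a b α h P s := by
  have hpos : ∀ x ∈ Ioi h, 0 < epsIntegrand a b α h P s x := fun x hx => by
    have hx0 : 0 < x := hh.trans hx
    rw [epsIntegrand_eq]
    exact mul_pos hx0 (meanLoss_pos ha hs hP hx0)
  unfold eps
  rw [setIntegral_pos_iff_support_of_nonneg_ae ?_ (integrableOn_epsIntegrand ha hα hh hP hs)]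
  · refine lt_of_lt_of_le ?_ (measure_mono (fun x hx => ⟨(hpos x hx).ne', hx⟩ :
      Ioi h ⊆ Function.support (epsIntegrand a b α h P s) ∩ Ioi h))
    simp
  · exact (ae_restrict_iff' measurableSet_Ioi).2 (Eventually.of_forall fun x hx => (hpos x hx).le)

/-- Change of variables `x = √(y² + h²)`, for which `x dx = y dy`. -/
lemma setIntegral_comp_sqrt_add_sq (hh : 0 < h) (f : ℝ → ℝ) :
    ∫ y in Ioi (0 : ℝ), y * f (√(y ^ 2 + h ^ 2)) = ∫ x in Ioi h, x * f x := by
  have himg : (fun y : ℝ => √(y ^ 2 + h ^ 2)) '' Ioi 0 = Ioi h := by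
    ext x
    constructor
    · rintro ⟨y, hy, rfl⟩
      refine Real.lt_sqrt_of_sq_lt ?_
      have : 0 < y ^ 2 := pow_pos hy 2
      linarith
    · intro hx
      have hx' : h < x := hx
      have h1 : 0 < x ^ 2 - h ^ 2 := by nlinarith
      refine ⟨√(x ^ 2 - h ^ 2), Real.sqrt_pos.2 h1, ?_⟩
      dsimp only
      rw [Real.sq_sqrt h1.le, sub_add_cancel, Real.sqrt_sq (hh.trans hx').le]
  have hinj : InjOn (fun y : ℝ => √(y ^ 2 + h ^ 2)) (Ioi 0) := fun y hy y' hy' he => by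
    have := (Real.sqrt_inj (by positivity) (by positivity)).1 he
    exact (pow_left_inj₀ (le_of_lt hy) (le_of_lt hy') two_ne_zero).1 (by linarith)
  have hderiv : ∀ y ∈ Ioi (0 : ℝ), HasDerivWithinAt (fun y : ℝ => √(y ^ 2 + h ^ 2))
      (y / √(y ^ 2 + h ^ 2)) (Ioi 0) y := fun y _ => by
    have h1 : HasDerivAt (fun y : ℝ => y ^ 2 + h ^ 2) (2 * y) y := by
      simpa using (hasDerivAt_pow 2 y).add_const (h ^ 2)
    have h2 := (h1.sqrt (by positivity)).hasDerivWithinAt (s := Ioi 0)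
    rwa [mul_div_mul_left _ _ two_ne_zero] at h2
  rw [← himg, integral_image_eq_integral_abs_deriv_smul measurableSet_Ioi hderiv hinj]
  refine setIntegral_congr_fun measurableSet_Ioi fun y hy => ?_
  have hy0 : 0 < y := hy
  have hs : 0 < √(y ^ 2 + h ^ 2) := Real.sqrt_pos.2 (by positivity)
  rw [abs_of_nonneg (by positivity), smul_eq_mul]
  field_simp

/-- Polar coordinates in the plane, in terms of the link distance. -/
lemma integral_comp_linkDist (hh : 0 < h) (f : ℝ → ℝ) :
    ∫ x : Plane, f (linkDist h x) = 2 * Real.pi * ∫ x in Ioi h, x * f x := by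
  have h1 := integral_fun_norm_addHaar (volume : Measure Plane) fun y => f (√(y ^ 2 + h ^ 2))
  unfold linkDist
  rw [h1, ← setIntegral_comp_sqrt_add_sq hh]
  have h2 : (volume : Measure Plane).real (Metric.ball 0 1) = Real.pi := by
    rw [measureReal_def, EuclideanSpace.volume_ball_fin_two]
    simp [Real.pi_pos.le]
  simp [h2, mul_assoc]

lemma lintegral_expNeg_expMeasure {u : ℝ} (hu : 0 ≤ u) :
    ∫⁻ g, expNeg (ENNReal.ofReal (u * g)) ∂expMeasure 1 = ENNReal.ofReal (1 / (1 + u)) := by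
  have hm : Measurable fun g : ℝ => expNeg (ENNReal.ofReal (u * g)) :=
    measurable_expNeg.comp (by fun_prop)
  have h1 : expMeasure 1 = volume.withDensity (exponentialPDF 1) := rfl
  have h2 : Measurable (exponentialPDF 1) := (measurable_exponentialPDFReal 1).ennreal_ofReal
  rw [h1, lintegral_withDensity_eq_lintegral_mul _ h2 hm]
  have h3 : ∀ g : ℝ, (exponentialPDF 1 * fun g : ℝ => expNeg (ENNReal.ofReal (u * g))) g
      = (Ici 0).indicator (fun g => ENNReal.ofReal (Real.exp (-(1 + u) * g))) g := fun g => by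
    rw [Pi.mul_apply]
    by_cases hg : 0 ≤ g
    · rw [indicator_of_mem (show g ∈ Ici (0 : ℝ) from hg), exponentialPDF_of_nonneg hg,
        expNeg_ofReal (by positivity), ← ENNReal.ofReal_mul (by positivity), one_mul, one_mul,
        ← Real.exp_add]
      congr 2; ring
    · rw [indicator_of_notMem (show g ∉ Ici (0 : ℝ) from hg), exponentialPDF_of_neg (not_le.1 hg), zero_mul]
  simp only [h3]
  rw [lintegral_indicator measurableSet_Ici, setLIntegral_congr Ioi_ae_eq_Ici.symm]
  have h4 : IntegrableOn (fun g => Real.exp (-(1 + u) * g)) (Ioi 0) :=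
    integrableOn_exp_mul_Ioi (by linarith) 0
  rw [← ofReal_integral_eq_lintegral_ofReal h4 (Eventually.of_forall fun g => (Real.exp_pos _).le),
    integral_exp_mul_Ioi (by linarith)]
  congr 1
  simp only [mul_zero, Real.exp_zero]
  rw [neg_div_neg_eq]

lemma lintegral_one_sub_expNeg_expMeasure {s q : ℝ} (hs : 0 ≤ s) (hq : 0 ≤ q) :
    ∫⁻ g, (1 - expNeg (ENNReal.ofReal s * ENNReal.ofReal (g * q))) ∂expMeasure 1
      = ENNReal.ofReal (1 - 1 / (1 + s * q)) := by
  have h1 : ∀ g : ℝ, ENNReal.ofReal s * ENNReal.ofReal (g * q) = ENNReal.ofReal (s * q * g) :=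
    fun g => by rw [← ENNReal.ofReal_mul hs]; congr 1; ring
  simp only [h1]
  have hsq : 0 ≤ s * q := mul_nonneg hs hq
  have hm : Measurable fun g : ℝ => expNeg (ENNReal.ofReal (s * q * g)) :=
    measurable_expNeg.comp (by fun_prop)
  rw [lintegral_sub hm _
    (Eventually.of_forall fun g => expNeg_le_one _), lintegral_expNeg_expMeasure hsq, lintegral_one,
    measure_univ, ENNReal.ofReal_sub _ (by positivity), ENNReal.ofReal_one]
  rw [lintegral_expNeg_expMeasure hsq]
  exact ENNReal.ofReal_ne_top

end Eps

lemma scaledTarget_pos {β P α y : ℝ} (hβ : 0 < β) (hP : 0 < P) (hy : 0 < y) :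
    0 < scaledTarget β P α y :=
  div_pos hβ (mul_pos hP (Real.rpow_pos_of_pos hy _))

/-! ### Lower bound for the exponent due to one layer -/

section Bound

variable {K : ℕ} {α : Channel → ℝ} {h P : Fin K → ℝ} {a : ℝ}

lemma ofReal_two_pi_eps_le (ha : 0 ≤ a) (b : ℝ) (hh : ∀ k, 0 < h k)
    (hP : ∀ k, 0 < P k) (j : Fin K) {s : ℝ} (hs : 0 < s) :
    ENNReal.ofReal (2 * Real.pi * eps a b α (h j) (P j) s)
      ≤ ∫⁻ z, (1 - expNeg (ENNReal.ofReal s * rxPower α h P z)) ∂layerIntensity a b h j := by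
  have hφ : Measurable fun z : Node K => 1 - expNeg (ENNReal.ofReal s * rxPower α h P z) :=
    measurable_const.sub (measurable_expNeg.comp ((measurable_rxPower α h P).const_mul _))
  have hc : ∀ c, ∫⁻ z, (1 - expNeg (ENNReal.ofReal s * rxPower α h P z)) ∂channelIntensity a b h j c
      = ∫⁻ x, ENNReal.ofReal (channelProb a b (h j) c (linkDist (h j) x)
        * (1 - 1 / (1 + s * P j * linkDist (h j) x ^ (-α c)))) := fun c => by
    rw [lintegral_channelIntensity a b h j c hφ]
    refine lintegral_congr fun x => ?_
    have := lintegral_one_sub_expNeg_expMeasure hs.le (linkPower_pos (hh j) (hP j) (α c) x).le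
    rw [ENNReal.ofReal_mul (channelProb_nonneg ha b _ _ _)]
    congr 1
    refine this.trans ?_
    unfold linkPower
    rw [← mul_assoc]
  have hd : ∀ x, 0 < linkDist (h j) x := linkDist_pos (hh j)
  have hmeas : Measurable fun x => meanLoss a b α (h j) (P j) s (linkDist (h j) x) :=
    (measurable_meanLoss _ _ _ _ _ _).comp (measurable_linkDist _)
  have hm : ∀ c, Measurable fun x => ENNReal.ofReal (channelProb a b (h j) c (linkDist (h j) x)
        * (1 - 1 / (1 + s * P j * linkDist (h j) x ^ (-α c)))) := fun c => by
    have h1 := (measurable_channelProb a b (h j) c).comp (measurable_linkDist (h j))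
    have h2 := measurable_linkDist (h j)
    simp only [Function.comp_def] at h1
    fun_prop
  unfold layerIntensity
  rw [lintegral_add_measure, hc, hc, ← lintegral_add_left (hm _)]
  have hsum : ∀ x, ENNReal.ofReal (channelProb a b (h j) .los (linkDist (h j) x)
        * (1 - 1 / (1 + s * P j * linkDist (h j) x ^ (-α .los))))
      + ENNReal.ofReal (channelProb a b (h j) .nlos (linkDist (h j) x)
        * (1 - 1 / (1 + s * P j * linkDist (h j) x ^ (-α .nlos))))
      = ENNReal.ofReal (meanLoss a b α (h j) (P j) s (linkDist (h j) x)) := fun x => by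
    have hnn : ∀ c, 0 ≤ channelProb a b (h j) c (linkDist (h j) x)
        * (1 - 1 / (1 + s * P j * linkDist (h j) x ^ (-α c))) := fun c => by
      have := hd x
      have := hP j
      exact mul_nonneg (channelProb_nonneg ha b _ _ _) (one_sub_one_div_nonneg (by positivity))
    rw [← ENNReal.ofReal_add (hnn _) (hnn _)]
    rfl
  simp only [hsum]
  have heps : 2 * Real.pi * eps a b α (h j) (P j) s
      = ∫ x : Plane, meanLoss a b α (h j) (P j) s (linkDist (h j) x) := by
    rw [integral_comp_linkDist (hh j) (meanLoss a b α (h j) (P j) s)]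
    unfold eps
    simp only [epsIntegrand_eq]
  rw [heps, integral_eq_lintegral_of_nonneg_ae
    (Eventually.of_forall fun x => (meanLoss_pos ha hs (hP j) (hd x)).le) hmeas.aestronglyMeasurable]
  -- Only this inequality is needed, so finiteness of the lower integral need not be checked here.
  exact ENNReal.ofReal_toReal_le

/-- The exponent of the success probability of a node, due to the nodes of layer `j`, is at least
the inverse of the density bound. -/
lemma ofReal_two_pi_eps_le_exponentBelow (ha : 0 ≤ a) (b : ℝ) (hα : ∀ c, 2 < α c)
    (hh : ∀ k, 0 < h k) (hP : ∀ k, 0 < P k) (j : Fin K) {β : ℝ} (hβ : 0 < β) {q : ℝ} (hq : 0 < q)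
    (hqj : q ≤ P j * h j ^ (-α .los)) :
    ENNReal.ofReal (2 * Real.pi * eps a b α (h j) (P j) (scaledTarget β (P j) (α .los) (h j)))
      ≤ exponentBelow id (avgPower α h P) (rxPower α h P) (layerIntensity a b h j)
          (ENNReal.ofReal β / ENNReal.ofReal q) q := by
  have hM := isRayleighModel_layerIntensity ha b hα hh hP j
  have hs := scaledTarget_pos (α := α .los) hβ (hP j) (hh j)
  refine (ofReal_two_pi_eps_le ha b hh hP j hs).trans ?_
  refine lintegral_mono_ae ?_
  have hae : ∀ᵐ w ∂layerIntensity a b h j, avgPower α h P w ≠ q := by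
    rw [ae_iff]
    simpa using hM.measure_level q
  filter_upwards [hae] with w hw
  -- Both factors grow: `β / q` is at least the scaled target, and replacing `r` by `∞` above the
  -- level only increases it. The level itself, where the value would be `0`, is null.
  refine tsub_le_tsub_left (expNeg_antitone (mul_le_mul' ?_ ?_)) 1
  · rw [← ENNReal.ofReal_div_of_pos hq]
    exact ENNReal.ofReal_le_ofReal (div_le_div_of_nonneg_left hβ.le hq hqj)
  · rcases lt_or_gt_of_ne hw with hlt | hlt
    · rw [powerBelow_of_lt (by exact hlt)]
    · rw [powerBelow_of_gt (by exact hlt)]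
      exact le_top

lemma avgPower_le (hαN : α .los ≤ α .nlos) (hαL : 0 < α .los) (hh : ∀ k, 0 < h k)
    (hP : ∀ k, 0 < P k)
    {j : Fin K} (hj : 1 ≤ h j ∨ α .los = α .nlos) {z : Node K} (hz : z.1 = j) :
    avgPower α h P z ≤ P j * h j ^ (-α .los) := by
  obtain ⟨k, x, c, g⟩ := z
  obtain rfl : k = j := hz
  have hc : α .los ≤ α c := by cases c <;> simp [hαN]
  refine mul_le_mul_of_nonneg_left ?_ (hP k).le
  refine (Real.rpow_le_rpow_of_nonpos (hh k) (le_linkDist (h k) x) (by linarith)).trans ?_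
  rcases hj with hj | hj
  · exact Real.rpow_le_rpow_of_exponent_le hj (by linarith)
  · have : α c = α .los := by cases c <;> simp [hj]
    rw [this]

end Bound

/-! ### Monotonicity in the density of one layer -/

lemma mul_exp_neg_lt {t u A : ℝ} (hA : 0 < A) (hu : 1 / A ≤ u) (htu : u < t) :
    t * Real.exp (-(t * A)) < u * Real.exp (-(u * A)) := by
  have hu0 : 0 < u := (one_div_pos.2 hA).trans_le hu
  have huA : 1 ≤ u * A := by rwa [div_le_iff₀ hA] at hu
  have h1 : (t - u) * A + 1 < Real.exp ((t - u) * A) :=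
    Real.add_one_lt_exp (mul_pos (sub_pos.2 htu) hA).ne'
  -- This is `u A ≥ 1` multiplied by `t - u`; with `1 + x < exp x` at `x = (t - u) A` it gives the
  -- claim.
  have h2 : t ≤ u * ((t - u) * A + 1) := by nlinarith
  have h3 : Real.exp (-(u * A)) = Real.exp ((t - u) * A) * Real.exp (-(t * A)) := by
    rw [← Real.exp_add]; congr 1; ring
  rw [h3, ← mul_assoc]
  exact mul_lt_mul_of_pos_right (h2.trans_lt (mul_lt_mul_of_pos_left h1 hu0)) (Real.exp_pos _)

lemma ofReal_mul_expNeg_lt {t u : ℝ} {A : ℝ≥0∞} (hA : A ≠ ∞) {c : ℝ} (hc : 0 < c)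
    (hcA : ENNReal.ofReal c ≤ A) (hu : 1 / c ≤ u) (htu : u < t) :
    ENNReal.ofReal t * expNeg (ENNReal.ofReal t * A)
      < ENNReal.ofReal u * expNeg (ENNReal.ofReal u * A) := by
  lift A to ℝ≥0 using hA
  rw [← ENNReal.ofReal_coe_nnreal] at hcA ⊢
  have hcA' : c ≤ A := (ENNReal.ofReal_le_ofReal_iff A.coe_nonneg).1 hcA
  have hu0 : 0 < u := (one_div_pos.2 hc).trans_le hu
  have ht0 : 0 < t := hu0.trans htu
  rw [← ENNReal.ofReal_mul ht0.le, ← ENNReal.ofReal_mul hu0.le, expNeg_ofReal (by positivity),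
    expNeg_ofReal (by positivity), ← ENNReal.ofReal_mul ht0.le, ← ENNReal.ofReal_mul hu0.le]
  refine (ENNReal.ofReal_lt_ofReal_iff (by positivity)).2
    (mul_exp_neg_lt (hc.trans_le hcA') (le_trans ?_ hu) htu)
  exact one_div_le_one_div_of_le hc hcA'

section Comparison

variable {E : Type*} [MeasurableSpace E] {p : E → ℝ} {r : E → ℝ≥0∞} {Λ Λ' : Measure E}

/-- The exponent is linear in the intensity, so the density `c` enters only through one exponential
factor. -/
lemma servedProb_smul_add {T : Type*} [LinearOrder T] (κ : ℝ → T) (p : E → ℝ) (r : E → ℝ≥0∞)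
    (Λ Λ' : Measure E) (c β ν : ℝ≥0∞) (q : ℝ) :
    servedProb κ p r (c • Λ + Λ') β ν q
      = expNeg (c * exponentBelow κ p r Λ (β / ENNReal.ofReal q) (κ q))
        * servedProb κ p r Λ' β ν q := by
  unfold servedProb exponentBelow
  rw [lintegral_add_measure, lintegral_smul_measure, expNeg_add, smul_eq_mul]
  ring

/-- Lowering the density of a layer raises the success probability, as long as this density is
above the inverse of the exponents due to the layer. -/
lemma lintegral_servedProb_lt (hM : IsRayleighModel p r Λ) (hM' : IsRayleighModel p r Λ')
    (hΛ : Λ ≠ 0) {β ν : ℝ≥0∞} (hβ : β ≠ ∞) (hν : ν ≠ ∞) {c : ℝ} (hc : 0 < c)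
    (hcΛ : ∀ᵐ z ∂Λ, ENNReal.ofReal c
      ≤ exponentBelow id p r Λ (β / ENNReal.ofReal (p z)) (p z))
    {t u : ℝ} (hu : 1 / c ≤ u) (htu : u < t)
    (hfin : ∫⁻ z, servedProb id p r (ENNReal.ofReal t • Λ + Λ') β ν (p z)
      ∂(ENNReal.ofReal t • Λ + Λ') ≠ ∞) :
    ∫⁻ z, servedProb id p r (ENNReal.ofReal t • Λ + Λ') β ν (p z) ∂(ENNReal.ofReal t • Λ + Λ')
      < ∫⁻ z, servedProb id p r (ENNReal.ofReal u • Λ + Λ') β ν (p z)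
        ∂(ENNReal.ofReal u • Λ + Λ') := by
  have hmeas : ∀ t : ℝ, Measurable fun z =>
      servedProb id p r (ENNReal.ofReal t • Λ + Λ') β ν (p z) := fun t =>
    ((hM.smul ENNReal.ofReal_ne_top).add hM').measurable_servedProb hβ ν
  have hs : ∀ z, β / ENNReal.ofReal (p z) ≠ ∞ := fun z =>
    ENNReal.div_ne_top hβ (by simpa using hM.avg_pos z)
  rw [lintegral_add_measure, lintegral_smul_measure, smul_eq_mul] at hfin
  rw [lintegral_add_measure, lintegral_smul_measure, smul_eq_mul, lintegral_add_measure,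
    lintegral_smul_measure, smul_eq_mul]
  -- Servers in the layer give the strict inequality, since their density multiplies the
  -- exponential; servers in the other layers only lose from more interference.
  refine ENNReal.add_lt_add_of_lt_of_le (ENNReal.add_ne_top.1 hfin).2 ?_
    (lintegral_mono fun z => ?_)
  · have h1 := (ENNReal.add_ne_top.1 hfin).1
    rw [← lintegral_const_mul _ (hmeas t)] at h1 ⊢
    rw [← lintegral_const_mul _ (hmeas u)]
    refine lintegral_strict_mono hΛ ((hmeas u).const_mul _).aemeasurable h1 ?_
    filter_upwards [hcΛ] with z hz
    rw [servedProb_smul_add, servedProb_smul_add, ← mul_assoc, ← mul_assoc]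
    refine ENNReal.mul_lt_mul_left ?_ ?_ (ofReal_mul_expNeg_lt
      (hM.exponentBelow_ne_top (hs z) (hM.avg_pos z)) hc hz hu htu)
    · exact mul_ne_zero (expNeg_pos (ENNReal.mul_ne_top (hs z) hν)).ne'
        (expNeg_pos (hM'.exponentBelow_ne_top (hs z) (hM.avg_pos z))).ne'
    · exact ne_top_of_le_ne_top (by simp) (IsRayleighModel.servedProb_le_one _ _ _ _ _ _ _)
  · dsimp only
    rw [servedProb_smul_add, servedProb_smul_add]
    gcongr
    exact expNeg_antitone (mul_le_mul_left (ENNReal.ofReal_le_ofReal htu.le) _)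

end Comparison

/-! ### The success probability of the layered network -/

section Layers

variable {K : ℕ} {α : Channel → ℝ} {h P : Fin K → ℝ} {a b β noise : ℝ}
variable {Ω : Type*} [MeasurableSpace Ω] {μ : Measure Ω} [IsProbabilityMeasure μ]

lemma stp_eq (ha : 0 ≤ a) (hα : ∀ c, 2 < α c) (hh : ∀ k, 0 < h k) (hP : ∀ k, 0 < P k)
    (hβ : 0 < β) (noise : ℝ) {Φ : Ω → Set (Node K)} {lam : Fin K → ℝ}
    (hΦ : IsPoissonPointProcess Φ (intensity a b h lam) μ) :
    ENNReal.ofReal (stp α h P β noise μ Φ)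
      = ∫⁻ z, servedProb id (avgPower α h P) (rxPower α h P) (intensity a b h lam)
          (ENNReal.ofReal β) (ENNReal.ofReal noise) (avgPower α h P z) ∂intensity a b h lam := by
  have hM : IsRayleighModel (avgPower α h P) (rxPower α h P) (intensity a b h lam) :=
    isRayleighModel_sum_layerIntensity ha b hα hh hP Finset.univ lam
  rw [← hM.measure_served hΦ (by simpa using hβ) ENNReal.ofReal_ne_top]
  exact ofReal_measureReal

lemma intensity_update (a b : ℝ) (h lam : Fin K → ℝ) (j : Fin K) (t : ℝ) :
    intensity a b h (Function.update lam j t) = ENNReal.ofReal t • layerIntensity a b h j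
      + ∑ k ∈ Finset.univ.erase j, ENNReal.ofReal (lam k) • layerIntensity a b h k := by
  unfold intensity
  rw [← Finset.add_sum_erase _ _ (Finset.mem_univ j), Function.update_self]
  congr 1
  refine Finset.sum_congr rfl fun k hk => ?_
  rw [Function.update_of_ne (Finset.ne_of_mem_erase hk)]
  rfl

/-- The success probability decreases strictly with the density of a layer above its bound. -/
lemma stp_update_lt (ha : 0 ≤ a) (hα : ∀ c, 2 < α c) (hαN : α .los ≤ α .nlos)
    (hh : ∀ k, 0 < h k) (hP : ∀ k, 0 < P k) (hβ : 0 < β)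
    {Φ : (Fin K → ℝ) → Ω → Set (Node K)}
    (hΦ : ∀ lam : Fin K → ℝ, (∀ k, 0 ≤ lam k) →
      IsPoissonPointProcess (Φ lam) (intensity a b h lam) μ)
    {lam : Fin K → ℝ} (hlam : ∀ k, 0 ≤ lam k) {j : Fin K} (hj : 1 ≤ h j ∨ α .los = α .nlos)
    {t u : ℝ} (hu : densityBound a b β α (h j) (P j) ≤ u) (htu : u < t) :
    stp α h P β noise μ (Φ (Function.update lam j t))
      < stp α h P β noise μ (Φ (Function.update lam j u)) := by
  have hM := isRayleighModel_layerIntensity ha b hα hh hP j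
  have heps : 0 < 2 * Real.pi * eps a b α (h j) (P j) (scaledTarget β (P j) (α .los) (h j)) :=
    mul_pos (by positivity) (eps_pos ha hα (hh j) (hP j) (scaledTarget_pos hβ (hP j) (hh j)))
  have hu0 : 0 ≤ u := (one_div_pos.2 heps).le.trans hu
  have hupd : ∀ v : ℝ, 0 ≤ v → ∀ k, 0 ≤ Function.update lam j v k := fun v hv k => by
    by_cases hk : k = j
    · subst hk; simpa using hv
    · simpa [Function.update_of_ne hk] using hlam k
  have ht := stp_eq ha hα hh hP hβ noise (hΦ _ (hupd t (hu0.trans htu.le)))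
  have hu' := stp_eq ha hα hh hP hβ noise (hΦ _ (hupd u hu0))
  rw [intensity_update] at ht hu'
  refine lt_of_not_ge fun hle => absurd (ENNReal.ofReal_le_ofReal hle) (not_le.2 ?_)
  rw [ht, hu']
  have hbound : ∀ q : ℝ, 0 < q → q ≤ P j * h j ^ (-α .los) → _ := fun q hq hqj =>
    ofReal_two_pi_eps_le_exponentBelow ha b hα hh hP j hβ hq hqj
  refine lintegral_servedProb_lt hM (isRayleighModel_sum_layerIntensity ha b hα hh hP _ lam) ?_
    ENNReal.ofReal_ne_top ENNReal.ofReal_ne_top heps ?_ hu htu (by rw [← ht]; simp)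
  -- A zero layer intensity would have zero exponent, against the positive lower bound.
  · intro h0
    have hq : 0 < P j * h j ^ (-α .los) := mul_pos (hP j) (Real.rpow_pos_of_pos (hh j) _)
    have h1 := hbound _ hq le_rfl
    rw [h0] at h1
    unfold exponentBelow at h1
    rw [lintegral_zero_measure, nonpos_iff_eq_zero, ENNReal.ofReal_eq_zero] at h1
    linarith
  · filter_upwards [ae_layerIntensity a b h j] with z hz
    exact hbound _ (hM.avg_pos z)
      (avgPower_le hαN (by linarith [hα .los]) hh hP hj hz)

end Layers

end MAN

theorem corollary1 {K : ℕ} (a b β noise : ℝ) (α : MAN.Channel → ℝ) (h P : Fin K → ℝ)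
    (ha : 0 ≤ a) (hβ : 0 < β) (hnoise : 0 ≤ noise)
    (hαL : 2 < α .los) (hαN : α .los ≤ α .nlos)
    (hh : ∀ k, 0 < h k) (hP : ∀ k, 0 < P k)
    {Ω : Type*} [MeasurableSpace Ω] (μ : Measure Ω) [IsProbabilityMeasure μ]
    (Φ : (Fin K → ℝ) → Ω → Set (MAN.Node K))
    (hΦ : ∀ lam : Fin K → ℝ, (∀ k, 0 ≤ lam k) →
      MAN.IsPoissonPointProcess (Φ lam) (MAN.intensity a b h lam) μ)
    (lam : Fin K → ℝ) (hlam : ∀ k, 0 ≤ lam k) :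
    (∀ j : Fin K, (1 ≤ h j ∨ α .los = α .nlos) →
      IntegrableOn (MAN.epsIntegrand a b α (h j) (P j)
        (MAN.scaledTarget β (P j) (α .los) (h j))) (Ioi (h j)) ∧
      (MAN.IsOptimalDensity (fun l => MAN.stp α h P β noise μ (Φ l)) lam j →
        lam j ≤ MAN.densityBound a b β α (h j) (P j))) ∧
    ((∀ j : Fin K, 1 ≤ h j ∨ α .los = α .nlos) →
      (∀ j : Fin K, MAN.IsOptimalDensity (fun l => MAN.stp α h P β noise μ (Φ l)) lam j) →
        ∑ j, lam j ≤ ∑ j, MAN.densityBound a b β α (h j) (P j)) := by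
  have hα : ∀ c, 2 < α c := by
    rintro (_ | _)
    · exact hαL
    · exact hαL.trans_le hαN
  have hmain : ∀ j : Fin K, (1 ≤ h j ∨ α .los = α .nlos) →
      MAN.IsOptimalDensity (fun l => MAN.stp α h P β noise μ (Φ l)) lam j →
        lam j ≤ MAN.densityBound a b β α (h j) (P j) := fun j hj hopt => by
    by_contra hlt
    rw [not_le] at hlt
    have hpos : 0 < MAN.densityBound a b β α (h j) (P j) := one_div_pos.2 (mul_pos (by positivity)
      (MAN.eps_pos ha hα (hh j) (hP j) (MAN.scaledTarget_pos hβ (hP j) (hh j))))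
    -- The bound itself is the competing density; it is positive, hence admissible in the definition
    -- of optimality.
    have h1 := MAN.stp_update_lt (noise := noise) ha hα hαN hh hP hβ hΦ hlam hj le_rfl hlt
    rw [Function.update_eq_self] at h1
    exact absurd (hopt.2 _ hpos) (not_le.2 h1)
  refine ⟨fun j hj => ⟨MAN.integrableOn_epsIntegrand ha hα (hh j) (hP j)
    (MAN.scaledTarget_pos hβ (hP j) (hh j)), hmain j hj⟩, fun hj hopt => ?_⟩
  exact Finset.sum_le_sum fun j _ => hmain j (hj j) (hopt j)
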